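/- Let $E$ be a complex Banach lattice, i.e. the complexification $E = E_{\mathbb R} \oplus i E_{\mathbb R}$ of a real Banach lattice $E_{\mathbb R}$ (with modulus $|x+iy| = \sup_{\theta\in\mathbb R} (\cos\theta\, x + \sin\theta\, y)$ and norm $\|z\| = \| |z| \|$), and assume that $E$ is a KB-space, i.e. every norm-bounded increasing sequence of positive elements of $E_{\mathbb R}$ converges in norm. Let $T$ be a positive bounded linear operator on $E$ with spectral radius $r(T)=1$. Assume that $T$ is (WS)-bounded: there is a net $(f_j)_{j\in J}$ of functions, each analytic on a neighbourhood of the closed unit disk, such that $f_j(1)=1$ and $f_j^{(k)}(0) \ge 0$ for all $j \in J$ and all integers $k\ge 0$, such that $\lim_j f_j(z) = 0$ for every $z\in\mathbb C$ with $|z|<1$, and such that $\sup_{j\in J}\|f_j(T)\|<\infty$, where $f_j(T)=\sum_{k\ge 0} \frac{f_j^{(k)}(0)}{k!}T^k$. Then for every $\theta\in\mathbb R$ and every $n\in\mathbb Z$ $$\dim\ker(e^{i\theta}-T)\le\dim\ker(e^{in\theta}-T),$$ where dimensions take values in $\{0,1,2,\dots\}\cup\{\infty\}$ (infinite cardinalities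 are not distinguished). In particular, the peripheral point spectrum $\{\lambda\in\mathbb C : \lambda \text{ is an eigenvalue of } T,\ |\lambda|=r(T)\}$ is cyclic: if it contains $re^{i\theta}$ with $r \ge 0$ and $\theta \in \mathbb R$, then it contains $re^{in\theta}$ for every $n\in\mathbb Z$. -/

import Mathlib

open Filter Topology
open scoped ENNReal

universe u v

/-! ## The complexification of a real Banach lattice

A real Banach lattice is a complete real normed space `F` with a compatible lattice order and a
solid norm.  A complex Banach lattice is by definition the complexification `F ⊕ i F`, with modulus
`|x + i y| = sup_θ (cos θ • x + sin θ • y)` and norm `‖z‖ = ‖ |z| ‖`. -/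

/-- Elements `re + i im` of the complexification of the real vector space `F`. -/
@[ext]
structure Complexification (F : Type u) : Type u where
  /-- real part -/
  re : F
  /-- imaginary part -/
  im : F

namespace Complexification

section Algebra

variable {F : Type u} [AddCommGroup F]

instance : Zero (Complexification F) := ⟨⟨0, 0⟩⟩
instance : Add (Complexification F) := ⟨fun z w => ⟨z.re + w.re, z.im + w.im⟩⟩
instance : Neg (Complexification F) := ⟨fun z => ⟨-z.re, -z.im⟩⟩
instance : Sub (Complexification F) := ⟨fun z w => ⟨z.re - w.re, z.im - w.im⟩⟩

@[simp] theorem zero_re : (0 : Complexification F).re = 0 := rfl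
@[simp] theorem zero_im : (0 : Complexification F).im = 0 := rfl
@[simp] theorem add_re (z w : Complexification F) : (z + w).re = z.re + w.re := rfl
@[simp] theorem add_im (z w : Complexification F) : (z + w).im = z.im + w.im := rfl
@[simp] theorem neg_re (z : Complexification F) : (-z).re = -z.re := rfl
@[simp] theorem neg_im (z : Complexification F) : (-z).im = -z.im := rfl
@[simp] theorem sub_re (z w : Complexification F) : (z - w).re = z.re - w.re := rfl
@[simp] theorem sub_im (z w : Complexification F) : (z - w).im = z.im - w.im := rfl

instance : AddCommGroup (Complexification F) where
  add_assoc a b c := by ext <;> simp [add_assoc]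
  zero_add a := by ext <;> simp
  add_zero a := by ext <;> simp
  add_comm a b := by ext <;> simp [add_comm]
  neg_add_cancel a := by ext <;> simp
  sub_eq_add_neg a b := by ext <;> simp [sub_eq_add_neg]
  nsmul := nsmulRec
  zsmul := zsmulRec

variable [Module ℝ F]

/-- `(a + i b)(x + i y) = (a x - b y) + i (b x + a y)`. -/
instance : SMul ℂ (Complexification F) :=
  ⟨fun c z => ⟨c.re • z.re - c.im • z.im, c.im • z.re + c.re • z.im⟩⟩

@[simp] theorem smul_re (c : ℂ) (z : Complexification F) :
    (c • z).re = c.re • z.re - c.im • z.im := rfl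
@[simp] theorem smul_im (c : ℂ) (z : Complexification F) :
    (c • z).im = c.im • z.re + c.re • z.im := rfl

instance : Module ℂ (Complexification F) where
  one_smul z := by ext <;> simp
  mul_smul c d z := by
    ext <;> simp <;> module
  smul_zero c := by ext <;> simp
  smul_add c z w := by ext <;> simp <;> module
  add_smul c d z := by ext <;> simp <;> module
  zero_smul z := by ext <;> simp

/-- The canonical embedding of the real part `F` into its complexification. -/
def ofReal (x : F) : Complexification F := ⟨x, 0⟩

/-- The real vectors `cos θ • x + sin θ • y`, `θ ∈ ℝ`, belonging to `z = x + i y`. -/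
def rotations (z : Complexification F) : Set F :=
  Set.range fun θ : ℝ => Real.cos θ • z.re + Real.sin θ • z.im

end Algebra

section Lattice

set_option linter.unusedSectionVars false

variable {F : Type u} [NormedAddCommGroup F] [Lattice F] [HasSolidNorm F] [IsOrderedAddMonoid F]
  [NormedSpace ℝ F] [IsOrderedModule ℝ F]

theorem smul_le_smul_abs (r e : ℝ) (h : |r| ≤ e) (x : F) : r • x ≤ e • |x| := by
  have he : 0 ≤ e := (abs_nonneg r).trans h
  rcases le_total 0 r with hr | hr
  · calc r • x ≤ r • |x| := smul_le_smul_of_nonneg_left (le_abs_self x) hr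
      _ ≤ e • |x| := smul_le_smul_of_nonneg_right ((le_abs_self r).trans h) (abs_nonneg x)
  · calc r • x = (-r) • (-x) := by simp
      _ ≤ (-r) • |x| := smul_le_smul_of_nonneg_left (neg_le_abs x) (by linarith)
      _ ≤ e • |x| := smul_le_smul_of_nonneg_right ((neg_le_abs r).trans h) (abs_nonneg x)

/-- In a Banach lattice the supremum that defines the modulus exists. -/
theorem exists_isLUB_rotations [CompleteSpace F] (z : Complexification F) :
    ∃ m : F, IsLUB z.rotations m := by
  set a : ℝ → F := fun θ => Real.cos θ • z.re + Real.sin θ • z.im with ha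
  set w : F := |z.re| + |z.im| with hw
  have hw0 : 0 ≤ w := add_nonneg (abs_nonneg _) (abs_nonneg _)
  have key : ∀ θ φ e : ℝ, |Real.cos θ - Real.cos φ| ≤ e → |Real.sin θ - Real.sin φ| ≤ e →
      a θ ≤ a φ + e • w := by
    intro θ φ e h1 h2
    have e1 := smul_le_smul_abs _ _ h1 z.re
    have e2 := smul_le_smul_abs _ _ h2 z.im
    have : a θ = a φ + ((Real.cos θ - Real.cos φ) • z.re + (Real.sin θ - Real.sin φ) • z.im) := by
      simp only [ha]; module
    rw [this, hw, smul_add]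
    gcongr
  have hcover : ∀ e : ℝ, 0 < e → ∃ s : F, (∀ θ, a θ ≤ s + e • w) ∧
      ∀ b ∈ upperBounds z.rotations, s ≤ b := by
    intro e he
    have hb : Bornology.IsBounded (Set.range fun θ : ℝ => (Real.cos θ, Real.sin θ)) := by
      refine (Metric.isBounded_closedBall (x := (0 : ℝ × ℝ)) (r := 1)).subset ?_
      rintro _ ⟨θ, rfl⟩
      simp [Prod.norm_def, Real.abs_cos_le_one, Real.abs_sin_le_one]
    have htb : TotallyBounded (Set.range fun θ : ℝ => (Real.cos θ, Real.sin θ)) :=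
      (hb.isCompact_closure.totallyBounded).subset subset_closure
    obtain ⟨t, hts, htf, htc⟩ := Metric.finite_approx_of_totallyBounded htb e he
    obtain ⟨t', ht'⟩ : ∃ t' : Finset ℝ,
        ∀ p ∈ t, ∃ φ ∈ t', (Real.cos φ, Real.sin φ) = p := by
      classical
      choose! g hg using fun p (hp : p ∈ t) => hts hp
      refine ⟨htf.toFinset.image g, fun p hp => ⟨g p, ?_, hg p hp⟩⟩
      exact Finset.mem_image_of_mem _ (htf.mem_toFinset.2 hp)
    have hfin : ∀ θ, ∃ φ ∈ t', a θ ≤ a φ + e • w := by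
      intro θ
      have := htc ⟨θ, rfl⟩
      simp only [Set.mem_iUnion] at this
      obtain ⟨p, hp, hd⟩ := this
      obtain ⟨φ, hφ, rfl⟩ := ht' p hp
      rw [Metric.mem_ball, Prod.dist_eq, max_lt_iff, Real.dist_eq, Real.dist_eq] at hd
      exact ⟨φ, hφ, key _ _ _ hd.1.le hd.2.le⟩
    have hne : t'.Nonempty := by
      obtain ⟨φ, hφ, -⟩ := hfin 0
      exact ⟨φ, hφ⟩
    refine ⟨t'.sup' hne a, fun θ => ?_, fun b hb => ?_⟩
    · obtain ⟨φ, hφ, h⟩ := hfin θ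
      exact h.trans (by gcongr; exact Finset.le_sup' a hφ)
    · exact Finset.sup'_le _ _ fun φ _ => hb ⟨φ, rfl⟩
  choose s hs1 hs2 using fun n : ℕ => hcover (1 / ((n : ℝ) + 1)) (by positivity)
  have hle : ∀ m n, s m ≤ s n + (1 / ((n : ℝ) + 1)) • w := by
    intro m n
    refine hs2 m _ ?_
    rintro _ ⟨θ, rfl⟩
    exact hs1 n θ
  have hnorm : ∀ N m n, N ≤ m → N ≤ n →
      ‖s m - s n‖ ≤ (1 / ((N : ℝ) + 1)) * ‖w‖ := by
    intro N m n hm hn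
    have hmono : ∀ k : ℕ, N ≤ k → (1 / ((k : ℝ) + 1)) • w ≤ (1 / ((N : ℝ) + 1)) • w := by
      intro k hk
      refine smul_le_smul_of_nonneg_right ?_ hw0
      have : (N : ℝ) ≤ k := by exact_mod_cast hk
      gcongr
    have h0 : 0 ≤ (1 / ((N : ℝ) + 1)) := by positivity
    have habs : |s m - s n| ≤ |(1 / ((N : ℝ) + 1)) • w| := by
      rw [abs_of_nonneg (smul_nonneg h0 hw0)]
      refine abs_le'.2 ⟨?_, ?_⟩
      · rw [sub_le_iff_le_add']
        exact (hle m n).trans (by gcongr)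
      · rw [neg_sub, sub_le_iff_le_add']
        exact (hle n m).trans (by gcongr)
    refine (norm_le_norm_of_abs_le_abs habs).trans ?_
    rw [norm_smul, Real.norm_of_nonneg h0]
  have hlim0 : Tendsto (fun n : ℕ => 1 / ((n : ℝ) + 1)) atTop (𝓝 0) :=
    tendsto_one_div_add_atTop_nhds_zero_nat
  have hcau : CauchySeq s := by
    refine cauchySeq_of_le_tendsto_0 (fun N : ℕ => (1 / ((N : ℝ) + 1)) * ‖w‖) ?_ ?_
    · intro m n N hm hn
      rw [dist_eq_norm]
      exact hnorm N m n hm hn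
    · simpa using hlim0.mul_const ‖w‖
  obtain ⟨l, hl⟩ := cauchySeq_tendsto_of_complete hcau
  refine ⟨l, ?_, ?_⟩
  · rintro _ ⟨θ, rfl⟩
    have h1 : Tendsto (fun n : ℕ => s n + (1 / ((n : ℝ) + 1)) • w) atTop (𝓝 l) := by
      simpa using hl.add (hlim0.smul_const w)
    exact ge_of_tendsto' h1 fun n => hs1 n θ
  · intro b hb
    exact le_of_tendsto' hl fun n => hs2 n b hb

variable [CompleteSpace F]

/-- The modulus `|x + i y| = sup_θ (cos θ • x + sin θ • y)` of an element of the
complexification; it is an element of the real Banach lattice `F`. -/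
noncomputable def modulus (z : Complexification F) : F :=
  Classical.choose (exists_isLUB_rotations z)

theorem isLUB_modulus (z : Complexification F) : IsLUB z.rotations z.modulus :=
  Classical.choose_spec (exists_isLUB_rotations z)

theorem le_modulus (z : Complexification F) (θ : ℝ) :
    Real.cos θ • z.re + Real.sin θ • z.im ≤ z.modulus :=
  (isLUB_modulus z).1 ⟨θ, rfl⟩

theorem modulus_le {z : Complexification F} {b : F}
    (h : ∀ θ : ℝ, Real.cos θ • z.re + Real.sin θ • z.im ≤ b) : z.modulus ≤ b :=
  (isLUB_modulus z).2 (by rintro _ ⟨θ, rfl⟩; exact h θ)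

theorem abs_re_le_modulus (z : Complexification F) : |z.re| ≤ z.modulus :=
  abs_le'.2 ⟨by simpa using le_modulus z 0, by simpa using le_modulus z Real.pi⟩

theorem abs_im_le_modulus (z : Complexification F) : |z.im| ≤ z.modulus := by
  refine abs_le'.2 ⟨by simpa using le_modulus z (Real.pi / 2), ?_⟩
  simpa [Real.cos_neg, Real.sin_neg] using le_modulus z (-(Real.pi / 2))

theorem modulus_nonneg (z : Complexification F) : 0 ≤ z.modulus :=
  (abs_nonneg _).trans (abs_re_le_modulus z)

theorem modulus_le_abs_add_abs (z : Complexification F) : z.modulus ≤ |z.re| + |z.im| := by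
  refine modulus_le fun θ => ?_
  have h1 := smul_le_smul_abs _ _ (Real.abs_cos_le_one θ) z.re
  have h2 := smul_le_smul_abs _ _ (Real.abs_sin_le_one θ) z.im
  simpa using add_le_add h1 h2

theorem modulus_ofReal (x : F) : (ofReal x).modulus = |x| :=
  le_antisymm (by simpa [ofReal] using modulus_le_abs_add_abs (ofReal x))
    (abs_re_le_modulus (ofReal x))

theorem modulus_add_le (z w : Complexification F) :
    (z + w).modulus ≤ z.modulus + w.modulus := by
  refine modulus_le fun θ => ?_
  have := add_le_add (le_modulus z θ) (le_modulus w θ)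
  refine le_trans (le_of_eq ?_) this
  simp only [add_re, add_im]
  module

theorem modulus_smul_le (c : ℂ) (z : Complexification F) :
    (c • z).modulus ≤ ‖c‖ • z.modulus := by
  refine modulus_le fun θ => ?_
  have h := smul_le_smul_of_nonneg_left (le_modulus z (θ - c.arg)) (norm_nonneg c)
  refine le_trans (le_of_eq ?_) h
  have h1 : ‖c‖ * Real.cos c.arg = c.re := Complex.norm_mul_cos_arg c
  have h2 : ‖c‖ * Real.sin c.arg = c.im := Complex.norm_mul_sin_arg c
  simp only [smul_re, smul_im, Real.cos_sub, Real.sin_sub]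
  rw [← h1, ← h2]
  module

/-- The norm of a complex Banach lattice: `‖z‖ = ‖ |z| ‖`. -/
noncomputable instance : Norm (Complexification F) := ⟨fun z => ‖z.modulus‖⟩

theorem norm_def (z : Complexification F) : ‖z‖ = ‖z.modulus‖ := rfl

theorem norm_re_le (z : Complexification F) : ‖z.re‖ ≤ ‖z‖ :=
  norm_le_norm_of_abs_le_abs ((abs_re_le_modulus z).trans (le_abs_self _))

theorem norm_im_le (z : Complexification F) : ‖z.im‖ ≤ ‖z‖ :=
  norm_le_norm_of_abs_le_abs ((abs_im_le_modulus z).trans (le_abs_self _))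

theorem norm_le_add (z : Complexification F) : ‖z‖ ≤ ‖z.re‖ + ‖z.im‖ := by
  have h : |z.modulus| ≤ abs (|z.re| + |z.im|) := by
    rw [abs_of_nonneg (modulus_nonneg z)]
    exact (modulus_le_abs_add_abs z).trans (le_abs_self _)
  refine (norm_le_norm_of_abs_le_abs h).trans ((norm_add_le _ _).trans ?_)
  rw [norm_abs_eq_norm, norm_abs_eq_norm]

theorem norm_ofReal (x : F) : ‖ofReal x‖ = ‖x‖ := by
  rw [norm_def, modulus_ofReal, norm_abs_eq_norm]

theorem norm_smul_le' (c : ℂ) (z : Complexification F) : ‖c • z‖ ≤ ‖c‖ * ‖z‖ := by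
  have h : |(c • z).modulus| ≤ abs (‖c‖ • z.modulus) := by
    rw [abs_of_nonneg (modulus_nonneg _)]
    exact (modulus_smul_le c z).trans (le_abs_self _)
  refine (norm_le_norm_of_abs_le_abs h).trans ?_
  rw [norm_smul, norm_norm, norm_def]

theorem normedSpaceCore : NormedSpace.Core ℂ (Complexification F) where
  norm_nonneg z := norm_nonneg z.modulus
  norm_smul c z := by
    refine le_antisymm (norm_smul_le' c z) ?_
    rcases eq_or_ne c 0 with rfl | hc
    · rw [norm_zero, zero_mul]
      exact norm_nonneg ((0 : ℂ) • z).modulus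
    · have h := norm_smul_le' c⁻¹ (c • z)
      rw [inv_smul_smul₀ hc, norm_inv] at h
      have hc' : 0 < ‖c‖ := norm_pos_iff.2 hc
      calc ‖c‖ * ‖z‖ ≤ ‖c‖ * (‖c‖⁻¹ * ‖c • z‖) := by gcongr
        _ = ‖c • z‖ := by field_simp
  norm_triangle z w := by
    have h : |(z + w).modulus| ≤ |z.modulus + w.modulus| := by
      rw [abs_of_nonneg (modulus_nonneg _)]
      exact (modulus_add_le z w).trans (le_abs_self _)
    exact (norm_le_norm_of_abs_le_abs h).trans (norm_add_le _ _)
  norm_eq_zero_iff z := by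
    constructor
    · intro h
      ext
      · simpa using (norm_re_le z).trans h.le
      · simpa using (norm_im_le z).trans h.le
    · rintro rfl
      have h := norm_le_add (0 : Complexification F)
      rw [zero_re, zero_im, norm_zero, add_zero] at h
      exact le_antisymm h (norm_nonneg (modulus (0 : Complexification F)))

noncomputable instance : NormedAddCommGroup (Complexification F) :=
  NormedAddCommGroup.ofCore normedSpaceCore

noncomputable instance : NormedSpace ℂ (Complexification F) :=
  NormedSpace.ofCore normedSpaceCore

instance : CompleteSpace (Complexification F) := by
  refine Metric.complete_of_cauchySeq_tendsto fun z hz => ?_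
  rw [Metric.cauchySeq_iff] at hz
  have hre : CauchySeq fun n => (z n).re := by
    refine Metric.cauchySeq_iff.2 fun e he => ?_
    obtain ⟨N, hN⟩ := hz e he
    refine ⟨N, fun m hm n hn => lt_of_le_of_lt ?_ (hN m hm n hn)⟩
    rw [dist_eq_norm, dist_eq_norm]
    exact norm_re_le (z m - z n)
  have him : CauchySeq fun n => (z n).im := by
    refine Metric.cauchySeq_iff.2 fun e he => ?_
    obtain ⟨N, hN⟩ := hz e he
    refine ⟨N, fun m hm n hn => lt_of_le_of_lt ?_ (hN m hm n hn)⟩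
    rw [dist_eq_norm, dist_eq_norm]
    exact norm_im_le (z m - z n)
  obtain ⟨x, hx⟩ := cauchySeq_tendsto_of_complete hre
  obtain ⟨y, hy⟩ := cauchySeq_tendsto_of_complete him
  refine ⟨⟨x, y⟩, ?_⟩
  rw [tendsto_iff_norm_sub_tendsto_zero] at hx hy ⊢
  refine squeeze_zero (fun n => norm_nonneg _) (fun n => norm_le_add _) ?_
  simpa using hx.add hy

end Lattice

end Complexification

/-! ## KB-spaces and positive operators -/

/-- A Banach lattice is a KB-space if every norm-bounded increasing sequence of positive elements
converges in norm.  A complex Banach lattice is a KB-space if its real part `F` is one. -/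
def IsKBSpace (F : Type u) [NormedAddCommGroup F] [Lattice F] : Prop :=
  ∀ x : ℕ → F, Monotone x → (∀ n, 0 ≤ x n) → (∃ C : ℝ, ∀ n, ‖x n‖ ≤ C) →
    ∃ l : F, Tendsto x atTop (𝓝 l)

/-- A bounded operator `T` on a complex Banach lattice is positive (`T ≥ 0`) if it maps positive
(in particular real) vectors to positive vectors. -/
def IsPositiveOperator {F : Type u} [NormedAddCommGroup F] [Lattice F] [HasSolidNorm F]
    [IsOrderedAddMonoid F] [NormedSpace ℝ F] [IsOrderedModule ℝ F] [CompleteSpace F]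
    (T : Complexification F →L[ℂ] Complexification F) : Prop :=
  ∀ x : F, 0 ≤ x → ∃ y : F, 0 ≤ y ∧ T (Complexification.ofReal x) = Complexification.ofReal y

/-! ## Weighting schemes and (WS)-bounded operators -/

/-- A net `(f j)` of functions, analytic on (a neighbourhood of) the closed unit disk, is a
weighting scheme if `f j 1 = 1`, all derivatives `(f j)^(k) (0)` are non-negative reals, and
`f j z → 0` for `|z| < 1`. -/
structure IsWeightingScheme {J : Type v} [Preorder J] (f : J → ℂ → ℂ) : Prop where
  analytic : ∀ j, AnalyticOnNhd ℂ (f j) (Metric.closedBall 0 1)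
  map_one : ∀ j, f j 1 = 1
  nonneg : ∀ j k, 0 ≤ (iteratedDeriv k (f j) 0).re ∧ (iteratedDeriv k (f j) 0).im = 0
  tendsto_zero : ∀ z : ℂ, ‖z‖ < 1 → Tendsto (fun j => f j z) atTop (𝓝 0)

/-- The operator `f(T) = ∑ k, a k T ^ k`, where `f(z) = ∑ k, a k z ^ k` is the Taylor expansion of
`f` around `0`.  If `f` is analytic on the closed unit disk and `T` has spectral radius at most
`1`, then the series converges absolutely in operator norm, and its sum is the value of the
analytic functional calculus of `T` at `f`. -/
noncomputable def analyticCalculus {X : Type u} [NormedAddCommGroup X] [NormedSpace ℂ X]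
    (f : ℂ → ℂ) (T : X →L[ℂ] X) : X →L[ℂ] X :=
  ∑' k : ℕ, (iteratedDeriv k f 0 / (k.factorial : ℂ)) • T ^ k

/-- An operator `T` (of spectral radius `1`) is (WS)-bounded if the operators `f j (T)` are
uniformly bounded in norm for some weighting scheme `(f j)`, indexed by a directed set `J`. -/
def IsWSBounded {X : Type u} [NormedAddCommGroup X] [NormedSpace ℂ X] (T : X →L[ℂ] X) : Prop :=
  ∃ (J : Type v) (_ : Preorder J) (_ : IsDirectedOrder J) (_ : Nonempty J) (f : J → ℂ → ℂ),
    IsWeightingScheme f ∧ ∃ C : ℝ, ∀ j, ‖analyticCalculus (f j) T‖ ≤ C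

/-! ## Peripheral point spectrum -/

/-- The eigenvalues of `T` whose absolute value is the spectral radius of `T`. -/
def peripheralPointSpectrum {X : Type u} [NormedAddCommGroup X] [NormedSpace ℂ X]
    (T : X →L[ℂ] X) : Set ℂ :=
  {μ | Module.End.HasEigenvalue (T : X →ₗ[ℂ] X) μ ∧ (‖μ‖₊ : ℝ≥0∞) = spectralRadius ℂ T}

/-- `M ⊆ ℂ` is cyclic if `r e^{iθ} ∈ M` with `r ≥ 0` implies `r e^{inθ} ∈ M` for all `n ∈ ℤ`. -/
def IsCyclicSet (M : Set ℂ) : Prop :=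
  ∀ r θ : ℝ, 0 ≤ r → (r : ℂ) * Complex.exp (Complex.I * θ) ∈ M →
    ∀ n : ℤ, (r : ℂ) * Complex.exp (Complex.I * n * θ) ∈ M

/-- The dimension of a complex vector space, as an element of `{0, 1, 2, …, ∞}` (infinite
cardinalities are not distinguished). -/
noncomputable def complexDim (V : Type u) [AddCommGroup V] [Module ℂ V] : ℕ∞ :=
  Cardinal.toENat (Module.rank ℂ V)

/-!
Why the theorem is true.  Write `S` for the restriction of `T` to the real Banach lattice `F`.

*Domination by a fixed point.*  If `T z = μ • z` with `|μ| = 1`, then `|z| ≤ S |z|`.  Let `w` be the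
sum of the moduli of finitely many such eigenvectors, so that `S ^ N w` increases with `N`.  The
Taylor coefficients of the functions `f_j` of a weighting scheme are non-negative, sum to one, and
tend to zero along the net, so `f_j(T) w ≥ S ^ N w / 2` for suitable `j`; boundedness of `f_j(T)`
thus bounds the sequence, and in a KB-space it converges to a fixed point `y ≥ w`
(`IsPositiveOperator.exists_fixedPoint_ge`).

*Passing to a lattice automorphism.*  Although `S` need not be a lattice homomorphism, it becomes
one on its backward orbits that are dominated by multiples of `y`.  These orbits form a vector
lattice, with `(a ⊔ b) k = lim_m S ^ m (a (k + m) ⊔ b (k + m))`, an increasing limit that exists by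
the KB property (`orbitSpace_exists_sup`).  On this lattice `S` acts as an order automorphism
(`orbitShiftIso`) that fixes the order unit `y`, and an eigenvector `z` for `μ` dominated by `y` has
the backward orbit `μ⁻ᵏ z`.

*Composition operators.*  The lattice of orbits is Archimedean and complete for the gauge norm of
`y`, hence of the form `C(K)` by Kakutani's theorem (`exists_forall_latticeCharacters_eq`), where
`K` is the space of lattice characters; these are obtained from prime filters, and Stone-Weierstrass
gives surjectivity.  A lattice automorphism fixing the unit is a composition operator on `C(K)`, so
`h ↦ |h| (h / |h|) ^ n` maps eigenfunctions for `μ` to eigenfunctions for `μ ^ n`.  If `m`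
eigenfunctions are independent, their span has a basis dual to evaluations at `m` points of `K`;
this map fixes the values `0` and `1`, so the images of the basis are independent as well
(`exists_linearIndependent_eigenvectors`).
-/

/-! ### Kakutani's representation of lattices with an order unit -/

section Kakutani

variable {X : Type u} [AddCommGroup X] [Lattice X] [Module ℝ X]

/-- The real-valued linear lattice homomorphisms on `X` taking the value `1` at `e`, as a subset of
the product `X → ℝ`, from which it inherits the topology of pointwise convergence. -/
def latticeCharacters (e : X) : Set (X → ℝ) :=
  {χ | (∀ a b, χ (a + b) = χ a + χ b) ∧ (∀ (c : ℝ) a, χ (c • a) = c * χ a) ∧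
    (∀ a b, χ (a ⊔ b) = max (χ a) (χ b)) ∧ χ e = 1}

theorem latticeCharacters_mono {e : X} {χ : X → ℝ} (hχ : χ ∈ latticeCharacters e) {a b : X}
    (hab : a ≤ b) : χ a ≤ χ b := by
  have := hχ.2.2.1 a b
  rw [sup_eq_right.2 hab] at this
  exact this ▸ le_max_left _ _

theorem isCompact_latticeCharacters {e : X} (hunit : ∀ a : X, ∃ c : ℝ, a ≤ c • e) :
    IsCompact (latticeCharacters e) := by
  choose c hc using hunit
  refine (isCompact_univ_pi fun a : X => isCompact_Icc (a := -c (-a)) (b := c a)).of_isClosed_subset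
    ?_ ?_
  · simp only [latticeCharacters, Set.ofPred_and, Set.ofPred_forall]
    refine IsClosed.inter ?_ (IsClosed.inter ?_ (IsClosed.inter ?_ ?_))
    · exact isClosed_iInter fun a => isClosed_iInter fun b =>
        isClosed_eq (by fun_prop) (by fun_prop)
    · exact isClosed_iInter fun a => isClosed_iInter fun b =>
        isClosed_eq (by fun_prop) (by fun_prop)
    · exact isClosed_iInter fun a => isClosed_iInter fun b =>
        isClosed_eq (by fun_prop) (by fun_prop)
    · exact isClosed_eq (by fun_prop) (by fun_prop)
  · intro χ hχ a _
    have h1 : ∀ b : X, χ b ≤ c b := fun b => by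
      simpa [hχ.2.1, hχ.2.2.2] using latticeCharacters_mono hχ (hc b)
    have h2 : χ (-a) = -χ a := by simpa using hχ.2.1 (-1) a
    exact ⟨by linarith [h1 (-a)], h1 a⟩

variable [IsOrderedAddMonoid X] [IsOrderedModule ℝ X]

/-- A prime filter `P` on `X` that contains the elements `δ • e`, `δ > 0`, and no element `≤ 0`
gives a lattice character, namely `χ z = sup {t | z - t • e ∈ P}`. -/
theorem exists_latticeCharacter_of_primeFilter {e : X} (he : 0 ≤ e)
    (hunit : ∀ a : X, ∃ c : ℝ, a ≤ c • e) {P : Set X}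
    (hup : ∀ a b, a ≤ b → a ∈ P → b ∈ P) (hinf : ∀ a b, a ∈ P → b ∈ P → a ⊓ b ∈ P)
    (hsup : ∀ a b, a ⊔ b ∈ P → a ∈ P ∨ b ∈ P) (hnp : ∀ a, a ≤ 0 → a ∉ P)
    (heP : ∀ δ : ℝ, 0 < δ → δ • e ∈ P) :
    ∃ χ ∈ latticeCharacters e, ∀ z, ∀ t : ℝ, z - t • e ∈ P → t ≤ χ z := by
  have hmono : ∀ {s t : ℝ}, s ≤ t → s • e ≤ t • e := fun h => smul_le_smul_of_nonneg_right h he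
  have hpos : ∀ a, a ⊔ 0 ∈ P → a ∈ P := fun a h => (hsup _ _ h).resolve_right (hnp 0 le_rfl)
  have hadd : ∀ a b, a ∈ P → b ∈ P → a + b ∈ P := by
    intro a b ha hb
    -- `a + b ≥ 2 (a ⊓ b)`, and the positive part of `2 (a ⊓ b)` dominates `a ⊓ b`
    refine hup _ _ (add_le_add (inf_le_left : a ⊓ b ≤ a) (inf_le_right : a ⊓ b ≤ b)) (hpos _ ?_)
    refine hup _ _ ?_ (hinf a b ha hb)
    set c := a ⊓ b
    have h2 : (2 : ℝ) • c ≤ (2 : ℝ) • ((c + c) ⊔ 0) := by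
      have h1 : c + c ≤ (c + c) ⊔ 0 := le_sup_left
      have h0 : (0 : X) ≤ (c + c) ⊔ 0 := le_sup_right
      rw [two_smul, two_smul]
      exact h1.trans (le_add_of_nonneg_left h0)
    exact (smul_le_smul_iff_of_pos_left (by norm_num : (0 : ℝ) < 2)).1 h2
  set S : X → Set ℝ := fun z => {t | z - t • e ∈ P} with hS
  have hbdd : ∀ z c, z ≤ c • e → ∀ t ∈ S z, t ≤ c := by
    intro z c hz t ht
    by_contra! hlt
    exact hnp _ (sub_nonpos.2 (hz.trans (hmono hlt.le))) ht
  have hbddA : ∀ z, BddAbove (S z) := fun z => by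
    obtain ⟨c, hc⟩ := hunit z
    exact ⟨c, hbdd z c hc⟩
  have hmem : ∀ z (c s : ℝ), c • e ≤ z → s < c → s ∈ S z := by
    intro z c s hz hs
    refine hup _ _ ?_ (heP (c - s) (by linarith))
    rw [sub_smul]
    exact sub_le_sub_right hz _
  have hne : ∀ z, (S z).Nonempty := by
    intro z
    obtain ⟨c, hc⟩ := hunit (-z)
    exact ⟨-c - 1, hmem z (-c) _ (by rw [neg_smul]; exact neg_le.1 hc) (by linarith)⟩
  set χ : X → ℝ := fun z => sSup (S z) with hχ
  have hle : ∀ z, ∀ t ∈ S z, t ≤ χ z := fun z t ht => le_csSup (hbddA z) ht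
  have hχmono : ∀ a b, a ≤ b → χ a ≤ χ b := fun a b hab =>
    csSup_le (hne a) fun t ht => hle b t (hup _ _ (sub_le_sub_right hab _) ht)
  have hlt : ∀ z t, t < χ z → t ∈ S z := by
    intro z t ht
    obtain ⟨s, hs, hts⟩ := exists_lt_of_lt_csSup (hne z) ht
    exact hup _ _ (sub_le_sub_left (hmono hts.le) _) hs
  have hχe : ∀ c : ℝ, χ (c • e) = c := by
    intro c
    refine le_antisymm (csSup_le (hne _) (hbdd _ c le_rfl)) (le_of_forall_lt fun s hs => ?_)
    exact ((by linarith : s < (s + c) / 2)).trans_le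
      (hle _ _ (hmem _ c _ le_rfl (by linarith)))
  have hsuper : ∀ a b, χ a + χ b ≤ χ (a + b) := by
    intro a b
    refine le_of_forall_pos_le_add fun ε hε => ?_
    have h1 := hlt a (χ a - ε / 2) (by linarith)
    have h2 := hlt b (χ b - ε / 2) (by linarith)
    have h3 : χ a - ε / 2 + (χ b - ε / 2) ∈ S (a + b) := by
      have := hadd _ _ h1 h2
      rw [hS, Set.mem_ofPred_eq]
      convert this using 1
      module
    linarith [hle _ _ h3]
  have hneg : ∀ a, -χ a ≤ χ (-a) := by
    intro a
    refine le_of_forall_pos_le_add fun ε hε => ?_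
    -- `a - (χ a + ε / 2) • e` and `(χ a + ε) • e - a` have sum `(ε / 2) • e`, so their supremum is
    -- in `P`, but the first of them is not
    have h1 : χ a + ε / 2 ∉ S a := fun h => by linarith [hle _ _ h]
    have h2 : (a - (χ a + ε / 2) • e) ⊔ ((χ a + ε) • e - a) ∈ P := by
      refine hup _ _ ?_ (heP (ε / 4) (by linarith))
      set p := a - (χ a + ε / 2) • e
      set q := (χ a + ε) • e - a
      have h3 : p + q ≤ (p ⊔ q) + (p ⊔ q) := add_le_add le_sup_left le_sup_right
      have h4 : (2 : ℝ) • ((ε / 4) • e) ≤ (2 : ℝ) • (p ⊔ q) := by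
        rw [two_smul ℝ (p ⊔ q)]
        refine le_trans (le_of_eq ?_) h3
        simp only [p, q]
        module
      exact (smul_le_smul_iff_of_pos_left (by norm_num : (0 : ℝ) < 2)).1 h4
    have h3 : -(χ a + ε) ∈ S (-a) := by
      have := (hsup _ _ h2).resolve_left h1
      rw [hS, Set.mem_ofPred_eq]
      convert this using 1
      module
    linarith [hle _ _ h3]
  have hχadd : ∀ a b, χ (a + b) = χ a + χ b := by
    intro a b
    refine le_antisymm ?_ (hsuper a b)
    have h1 := hsuper (a + b) (-b)
    rw [add_neg_cancel_right] at h1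
    linarith [hneg b]
  have hχbound : ∀ a, ∃ C : ℝ, ∀ c : ℝ, |χ (c • a)| ≤ C * |c| := by
    intro a
    obtain ⟨c1, h1⟩ := hunit a
    obtain ⟨c2, h2⟩ := hunit (-a)
    set C := max |c1| |c2|
    have g1 : a ≤ C • e := h1.trans (hmono ((le_abs_self _).trans (le_max_left _ _)))
    have g2 : -a ≤ C • e := h2.trans (hmono ((le_abs_self _).trans (le_max_right _ _)))
    have key : ∀ c : ℝ, c • a ≤ (C * |c|) • e := by
      intro c
      rcases le_total 0 c with hc | hc
      · have := smul_le_smul_of_nonneg_left g1 hc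
        rw [abs_of_nonneg hc, mul_comm, ← smul_smul]
        exact this
      · have := smul_le_smul_of_nonneg_left g2 (neg_nonneg.2 hc)
        rw [smul_smul, mul_comm, ← abs_of_nonpos hc] at this
        refine le_trans (le_of_eq ?_) this
        rw [abs_of_nonpos hc]
        module
    refine ⟨C, fun c => abs_le'.2 ⟨?_, ?_⟩⟩
    · simpa [hχe] using hχmono _ _ (key c)
    · have := hχmono _ _ (key (-c))
      rw [hχe, abs_neg, neg_smul] at this
      exact (hneg _).trans this
  have hsmul : ∀ (c : ℝ) a, χ (c • a) = c * χ a := by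
    intro c a
    obtain ⟨C, hC⟩ := hχbound a
    -- an additive function on `ℝ` that is bounded by a multiple of `|c|` is linear
    let f : ℝ →+ ℝ := AddMonoidHom.mk' (fun c => χ (c • a)) fun s t => by
      rw [add_smul, hχadd]
    have hf : Continuous f := AddMonoidHomClass.continuous_of_bound f C fun c => hC c
    have := map_real_smul f hf c 1
    simpa [f] using this
  refine ⟨χ, ⟨hχadd, hsmul, fun a b => ?_, by simpa using hχe 1⟩, hle⟩
  refine le_antisymm ?_ (max_le (hχmono _ _ le_sup_left) (hχmono _ _ le_sup_right))
  refine csSup_le (hne _) fun t ht => ?_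
  have h1 : (a - t • e) ⊔ (b - t • e) ∈ P := by
    have h2 : a ⊔ b - t • e ∈ P := ht
    rwa [sub_eq_add_neg, sup_add, ← sub_eq_add_neg, ← sub_eq_add_neg] at h2
  rcases hsup _ _ h1 with h | h
  · exact (hle _ _ h).trans (le_max_left _ _)
  · exact (hle _ _ h).trans (le_max_right _ _)

/-- Lattice characters detect positivity: the filter generated by the positive multiples of
`(x - ε • e)⁺` is disjoint from the ideal of elements `≤ 0`, and can hence be enlarged to a prime
filter. -/
theorem exists_latticeCharacter_pos {e : X} (he : 0 ≤ e)
    (hunit : ∀ a : X, ∃ c : ℝ, a ≤ c • e)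
    (harch : ∀ a : X, (∀ ε : ℝ, 0 < ε → a ≤ ε • e) → a ≤ 0) {x : X} (hx : ¬ x ≤ 0) :
    ∃ χ ∈ latticeCharacters e, 0 < χ x := by
  obtain ⟨ε, hε, hxε⟩ : ∃ ε : ℝ, 0 < ε ∧ ¬ x ≤ ε • e := by
    by_contra! h
    exact hx (harch x h)
  set x' := (x - ε • e) ⊔ 0 with hx'
  have hx'0 : 0 ≤ x' := le_sup_right
  have hFil : Order.IsPFilter {z : X | ∃ δ : ℝ, 0 < δ ∧ δ • x' ≤ z} := by
    refine Order.IsPFilter.of_def ⟨x', 1, one_pos, by simp⟩ ?_ ?_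
    · rintro a ⟨δ, hδ, ha⟩ b ⟨η, hη, hb⟩
      refine ⟨a ⊓ b, ⟨min δ η, lt_min hδ hη, le_inf ?_ ?_⟩, inf_le_left, inf_le_right⟩
      · exact (smul_le_smul_of_nonneg_right (min_le_left _ _) hx'0).trans ha
      · exact (smul_le_smul_of_nonneg_right (min_le_right _ _) hx'0).trans hb
    · rintro a b hab ⟨δ, hδ, ha⟩
      exact ⟨δ, hδ, ha.trans hab⟩
  let _ : DistribLattice X := AddCommGroup.toDistribLattice X
  have hdis : Disjoint (hFil.toPFilter : Set X) (Order.Ideal.principal (0 : X) : Set X) := by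
    refine Set.disjoint_left.2 ?_
    rintro z ⟨δ, hδ, hz⟩ hz0
    have h1 : δ • x' ≤ δ • 0 := by simpa using hz.trans hz0
    have h2 := (smul_le_smul_iff_of_pos_left hδ).1 h1
    exact hxε (sub_nonpos.1 (le_sup_left.trans h2))
  obtain ⟨J, hJ, hIJ, hFJ⟩ := DistribLattice.prime_ideal_of_disjoint_filter_ideal hdis
  have hnp : ∀ a : X, a ≤ 0 → a ∉ (J : Set X)ᶜ := fun a ha h => h (hIJ ha)
  have hFP : ∀ z : X, (∃ δ : ℝ, 0 < δ ∧ δ • x' ≤ z) → z ∈ (J : Set X)ᶜ := fun z hz hzJ =>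
    Set.disjoint_left.1 hFJ hz hzJ
  obtain ⟨χ, hχ, hle⟩ := exists_latticeCharacter_of_primeFilter he hunit (P := (J : Set X)ᶜ)
    (fun a b hab ha hb => ha (J.lower hab hb))
    (fun a b ha hb hab => (hJ.mem_or_mem hab).elim ha hb)
    (fun a b hab => by
      by_contra! h
      exact hab (Order.Ideal.sup_mem (not_not.1 h.1) (not_not.1 h.2)))
    hnp
    (fun δ hδ => by
      obtain ⟨c, hc⟩ := hunit x'
      refine hFP _ ⟨δ / (|c| + 1), by positivity, ?_⟩
      have h1 : x' ≤ (|c| + 1) • e :=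
        hc.trans (smul_le_smul_of_nonneg_right (by linarith [le_abs_self c]) he)
      have h2 := smul_le_smul_of_nonneg_left h1 (by positivity : 0 ≤ δ / (|c| + 1))
      rwa [smul_smul, div_mul_cancel₀ _ (by positivity)] at h2)
  refine ⟨χ, hχ, hε.trans_le (hle x ε fun hJx => ?_)⟩
  exact hFP x' ⟨1, one_pos, by simp⟩ (Order.Ideal.sup_mem hJx (hIJ (le_refl (0 : X))))

theorem le_of_forall_latticeCharacters {e : X} (he : 0 ≤ e)
    (hunit : ∀ a : X, ∃ c : ℝ, a ≤ c • e)
    (harch : ∀ a : X, (∀ ε : ℝ, 0 < ε → a ≤ ε • e) → a ≤ 0) {a b : X}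
    (h : ∀ χ ∈ latticeCharacters e, χ a ≤ χ b) : a ≤ b := by
  by_contra hab
  obtain ⟨χ, hχ, hpos⟩ := exists_latticeCharacter_pos he hunit harch
    (x := a - b) (fun h' => hab (sub_nonpos.1 h'))
  have h1 := hχ.1 (a - b) b
  rw [sub_add_cancel] at h1
  linarith [h χ hχ]

/-- **Kakutani's theorem**: in an Archimedean vector lattice that is complete for the gauge norm of
an order unit `e`, every continuous function on the space of lattice characters is the evaluation
at some element. -/
theorem exists_forall_latticeCharacters_eq {e : X} (he : 0 ≤ e)
    (hunit : ∀ a : X, ∃ c : ℝ, a ≤ c • e)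
    (harch : ∀ a : X, (∀ ε : ℝ, 0 < ε → a ≤ ε • e) → a ≤ 0)
    (hcomplete : ∀ a : ℕ → X,
      (∀ ε : ℝ, 0 < ε → ∃ N, ∀ m ≥ N, ∀ n ≥ N, a m ≤ a n + ε • e) →
      ∃ l : X, ∀ ε : ℝ, 0 < ε → ∃ N, ∀ n ≥ N, a n ≤ l + ε • e ∧ l ≤ a n + ε • e)
    (f : C(latticeCharacters e, ℝ)) : ∃ a : X, ∀ χ : latticeCharacters e, χ.1 a = f χ := by
  have : CompactSpace (latticeCharacters e) :=
    isCompact_iff_compactSpace.1 (isCompact_latticeCharacters hunit)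
  let ev : X → C(latticeCharacters e, ℝ) := fun a =>
    ⟨fun χ => χ.1 a, (continuous_apply a).comp continuous_subtype_val⟩
  have hinfχ : ∀ χ ∈ latticeCharacters e, ∀ a b : X, χ (a ⊓ b) = min (χ a) (χ b) := by
    intro χ hχ a b
    have h1 := hχ.1 (a ⊓ b) (a ⊔ b)
    rw [inf_add_sup, hχ.1, hχ.2.2.1] at h1
    linarith [min_add_max (χ a) (χ b)]
  have hdense : closure (Set.range ev) = ⊤ := by
    refine ContinuousMap.sublattice_closure_eq_top _ ⟨_, 0, rfl⟩ ?_ ?_ ?_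
    · rintro _ ⟨a, rfl⟩ _ ⟨b, rfl⟩
      exact ⟨a ⊓ b, ContinuousMap.ext fun χ => hinfχ χ.1 χ.2 a b⟩
    · rintro _ ⟨a, rfl⟩ _ ⟨b, rfl⟩
      exact ⟨a ⊔ b, ContinuousMap.ext fun χ => χ.2.2.2.1 a b⟩
    · intro w χ ψ
      by_cases hχψ : χ = ψ
      · subst hχψ
        refine ⟨_, ⟨w χ • e, rfl⟩, ?_, ?_⟩ <;> simp [ev, χ.2.2.1, χ.2.2.2.2]
      · obtain ⟨a, ha⟩ : ∃ a, χ.1 a ≠ ψ.1 a := by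
          by_contra! h
          exact hχψ (Subtype.ext (funext h))
        have hd : χ.1 a - ψ.1 a ≠ 0 := sub_ne_zero.2 ha
        set s := (w χ - w ψ) / (χ.1 a - ψ.1 a)
        have hs : s * (χ.1 a - ψ.1 a) = w χ - w ψ := div_mul_cancel₀ _ hd
        refine ⟨_, ⟨s • a + (w χ - s * χ.1 a) • e, rfl⟩, ?_, ?_⟩
        · simp [ev, χ.2.1, χ.2.2.1, χ.2.2.2.2]
        · simp only [ev, ContinuousMap.coe_mk, ψ.2.1, ψ.2.2.1, ψ.2.2.2.2]
          linarith
  have hf : ∀ k : ℕ, ∃ a : X, ∀ χ : latticeCharacters e, |χ.1 a - f χ| ≤ 1 / ((k : ℝ) + 1) := by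
    intro k
    have h1 : f ∈ closure (Set.range ev) := by rw [hdense]; trivial
    obtain ⟨_, ⟨a, rfl⟩, ha⟩ := Metric.mem_closure_iff.1 h1 (1 / ((k : ℝ) + 1)) (by positivity)
    refine ⟨a, fun χ => ?_⟩
    have h2 := (ContinuousMap.dist_apply_le_dist (f := f) (g := ev a) χ).trans ha.le
    rwa [dist_comm, Real.dist_eq] at h2
  choose a ha using hf
  have hsmall : ∀ ε : ℝ, 0 < ε → ∃ N : ℕ, ∀ n ≥ N, ∀ χ : latticeCharacters e,
      |χ.1 (a n) - f χ| ≤ ε := by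
    intro ε hε
    obtain ⟨N, hN⟩ := exists_nat_one_div_lt hε
    refine ⟨N, fun n hn χ => (ha n χ).trans (le_trans ?_ hN.le)⟩
    have : (N : ℝ) ≤ n := by exact_mod_cast hn
    gcongr
  obtain ⟨l, hl⟩ := hcomplete a fun ε hε => by
    obtain ⟨N, hN⟩ := hsmall (ε / 2) (by linarith)
    refine ⟨N, fun m hm n hn => le_of_forall_latticeCharacters he hunit harch fun χ hχ => ?_⟩
    rw [hχ.1, hχ.2.1, hχ.2.2.2]
    have h1 := abs_le.1 (hN m hm ⟨χ, hχ⟩)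
    have h2 := abs_le.1 (hN n hn ⟨χ, hχ⟩)
    simp only at h1 h2
    linarith [h1.2, h2.1]
  refine ⟨l, fun χ => eq_of_abs_sub_le_all fun ε hε => ?_⟩
  obtain ⟨N, hN⟩ := hsmall (ε / 2) (by linarith)
  obtain ⟨M, hM⟩ := hl (ε / 2) (by linarith)
  obtain ⟨h1, h2⟩ := hM (max N M) (le_max_right _ _)
  have h3 := abs_le.1 (hN (max N M) (le_max_left _ _) χ)
  have h4 := latticeCharacters_mono χ.2 h1
  have h5 := latticeCharacters_mono χ.2 h2
  rw [χ.2.1, χ.2.2.1, χ.2.2.2.2] at h4 h5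
  exact abs_le.2 ⟨by linarith [h3.1], by linarith [h3.2]⟩

end Kakutani

/-! ### Eigenvectors of lattice homomorphisms -/

/-- The complexification of a real linear map. -/
def Complexification.mapReal {X Y : Type u} [AddCommGroup X] [Module ℝ X] [AddCommGroup Y]
    [Module ℝ Y] (σ : X →ₗ[ℝ] Y) : Complexification X →ₗ[ℂ] Complexification Y where
  toFun z := ⟨σ z.re, σ z.im⟩
  map_add' z w := by ext <;> simp
  map_smul' c z := by ext <;> simp

/-- The complex-linear extension of a real functional to the complexification. -/
noncomputable def Complexification.extendFunctional {X : Type u} [AddCommGroup X] [Module ℝ X]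
    (χ : X →ₗ[ℝ] ℝ) : Complexification X →ₗ[ℂ] ℂ where
  toFun z := ⟨χ z.re, χ z.im⟩
  map_add' z w := by apply Complex.ext <;> simp
  map_smul' c z := by
    apply Complex.ext
    · simp
    · simp
      ring

/-- The map `r e^{iφ} ↦ r e^{inφ}`. -/
noncomputable def polarPow (n : ℤ) (z : ℂ) : ℂ := ‖z‖ * (z / ‖z‖) ^ n

theorem norm_polarPow (n : ℤ) (z : ℂ) : ‖polarPow n z‖ = ‖z‖ := by
  rcases eq_or_ne z 0 with rfl | hz
  · simp [polarPow]
  · have : ‖z‖ ≠ 0 := norm_ne_zero_iff.2 hz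
    simp [polarPow, this]

theorem polarPow_zero (n : ℤ) : polarPow n 0 = 0 := by simp [polarPow]

theorem polarPow_one (n : ℤ) : polarPow n 1 = 1 := by simp [polarPow]

theorem polarPow_mul {n : ℤ} {μ : ℂ} (hμ : ‖μ‖ = 1) (z : ℂ) :
    polarPow n (μ * z) = μ ^ n * polarPow n z := by
  simp only [polarPow, norm_mul, hμ, one_mul, mul_div_assoc, mul_zpow]
  ring

theorem continuous_polarPow (n : ℤ) : Continuous (polarPow n) := by
  refine continuous_iff_continuousAt.2 fun z => ?_
  rcases eq_or_ne z 0 with rfl | hz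
  · rw [ContinuousAt, polarPow_zero, tendsto_zero_iff_norm_tendsto_zero]
    simp only [norm_polarPow]
    simpa using (continuous_norm (E := ℂ)).tendsto 0
  · have h0 : (‖z‖ : ℂ) ≠ 0 := by simpa using hz
    have h1 : ContinuousAt (fun z : ℂ => (‖z‖ : ℂ)) z := by fun_prop
    exact h1.mul ((continuousAt_id.div h1 h0).zpow₀ n (Or.inl (div_ne_zero hz h0)))

/-- A family of functionals that separates the points of a span of `m` independent vectors contains
`m` functionals that are a dual basis to some vectors of that span. -/
theorem exists_biorthogonal {K M ι : Type*} [Field K] [AddCommGroup M] [Module K M]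
    (Φ : ι → M →ₗ[K] K) {m : ℕ} {v : Fin m → M} (hv : LinearIndependent K v)
    (hsep : ∀ x ∈ Submodule.span K (Set.range v), (∀ i, Φ i x = 0) → x = 0) :
    ∃ (j : Fin m → ι) (w : Fin m → M), (∀ a, w a ∈ Submodule.span K (Set.range v)) ∧
      ∀ a b, Φ (j a) (w b) = if a = b then 1 else 0 := by
  classical
  set V := Submodule.span K (Set.range v)
  let bv : Module.Basis (Fin m) K V := Module.Basis.span hv
  have : Module.Finite K V := Module.Finite.of_basis bv
  set Ψ : ι → Module.Dual K V := fun i => (Φ i).comp V.subtype with hΨ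
  have hspan : Submodule.span K (Set.range Ψ) = ⊤ := by
    have h0 : (Submodule.span K (Set.range Ψ)).dualCoannihilator = ⊥ := by
      refine (Submodule.eq_bot_iff _).2 fun x hx => ?_
      refine Subtype.ext (hsep x x.2 fun i => ?_)
      exact (Submodule.mem_dualCoannihilator x).1 hx _ (Submodule.subset_span ⟨i, rfl⟩)
    rw [← Subspace.dualCoannihilator_dualAnnihilator_eq (W := Submodule.span K (Set.range Ψ)), h0,
      Submodule.dualAnnihilator_bot]
  obtain ⟨s, hs, hspan', hli⟩ := exists_linearIndependent K (Set.range Ψ)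
  rw [hspan] at hspan'
  let b0 : Module.Basis s K (Module.Dual K V) := Module.Basis.mk hli (by
    rw [Subtype.range_coe, hspan'])
  have : Fintype s := FiniteDimensional.fintypeBasisIndex b0
  have hcard : Fintype.card s = m := by
    rw [← Module.finrank_eq_card_basis b0, Subspace.dual_finrank_eq,
      Module.finrank_eq_card_basis bv, Fintype.card_fin]
  let b := b0.reindex (Fintype.equivFinOfCardEq hcard)
  have hb : ∀ a, ∃ i, Ψ i = b a := by
    intro a
    have : b a = ((Fintype.equivFinOfCardEq hcard).symm a : Module.Dual K V) := by
      simp [b, b0]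
    rw [this]
    exact hs (Subtype.property _)
  choose j hj using hb
  refine ⟨j, fun a => ((Module.evalEquiv K V).symm (b.dualBasis a) : V),
    fun a => Subtype.property _, fun a c => ?_⟩
  have h1 : Ψ (j a) ((Module.evalEquiv K V).symm (b.dualBasis c)) = if a = c then 1 else 0 := by
    rw [Module.apply_evalEquiv_symm_apply, hj, Module.Basis.dualBasis_apply_self]
  exact h1

/-- If `σ` is a lattice homomorphism that fixes the order unit `e`, then `χ ↦ χ ∘ σ` maps lattice
characters to lattice characters, so `σ` is a composition operator in the Kakutani representation.
An eigenfunction `h` for the unimodular eigenvalue `μ` hence gives the eigenfunction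
`polarPow n ∘ h` for `μ ^ n`. -/
theorem exists_linearIndependent_eigenvectors {X : Type u} [AddCommGroup X] [Lattice X]
    [IsOrderedAddMonoid X] [Module ℝ X] [IsOrderedModule ℝ X] {e : X} (he : 0 ≤ e)
    (hunit : ∀ a : X, ∃ c : ℝ, a ≤ c • e)
    (harch : ∀ a : X, (∀ ε : ℝ, 0 < ε → a ≤ ε • e) → a ≤ 0)
    (hcomplete : ∀ a : ℕ → X,
      (∀ ε : ℝ, 0 < ε → ∃ N, ∀ m ≥ N, ∀ n ≥ N, a m ≤ a n + ε • e) →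
      ∃ l : X, ∀ ε : ℝ, 0 < ε → ∃ N, ∀ n ≥ N, a n ≤ l + ε • e ∧ l ≤ a n + ε • e)
    {σ : X →ₗ[ℝ] X} (hσ : ∀ a b, σ (a ⊔ b) = σ a ⊔ σ b) (hσe : σ e = e)
    {μ : ℂ} (hμ : ‖μ‖ = 1) (n : ℤ) {m : ℕ} {h : Fin m → Complexification X}
    (hli : LinearIndependent ℂ h) (heig : ∀ i, Complexification.mapReal σ (h i) = μ • h i) :
    ∃ g : Fin m → Complexification X, LinearIndependent ℂ g ∧
      ∀ i, Complexification.mapReal σ (g i) = μ ^ n • g i := by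
  let lin : latticeCharacters e → X →ₗ[ℝ] ℝ := fun χ =>
    { toFun := χ.1, map_add' := χ.2.1, map_smul' := χ.2.2.1 }
  let Φ : latticeCharacters e → Complexification X →ₗ[ℂ] ℂ := fun χ =>
    Complexification.extendFunctional (lin χ)
  have hsepX : ∀ a b : X, (∀ χ : latticeCharacters e, χ.1 a = χ.1 b) → a = b := fun a b hab =>
    le_antisymm
      (le_of_forall_latticeCharacters he hunit harch fun χ hχ => (hab ⟨χ, hχ⟩).le)
      (le_of_forall_latticeCharacters he hunit harch fun χ hχ => (hab ⟨χ, hχ⟩).ge)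
  have hsep : ∀ z w : Complexification X, (∀ χ, Φ χ z = Φ χ w) → z = w := fun z w hzw =>
    Complexification.ext (hsepX _ _ fun χ => congrArg Complex.re (hzw χ))
      (hsepX _ _ fun χ => congrArg Complex.im (hzw χ))
  have hcomp : ∀ χ : latticeCharacters e, ∃ ψ : latticeCharacters e,
      ∀ z, Φ χ (Complexification.mapReal σ z) = Φ ψ z := fun χ =>
    ⟨⟨fun a => χ.1 (σ a), fun a b => by simp [χ.2.1], fun c a => by simp [χ.2.2.1],
      fun a b => by simp [hσ, χ.2.2.2.1], by simp [hσe, χ.2.2.2.2]⟩, fun z => rfl⟩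
  have hpow : ∀ z : Complexification X, ∃ g : Complexification X,
      ∀ χ, Φ χ g = polarPow n (Φ χ z) := by
    intro z
    have hcont : Continuous fun χ : latticeCharacters e => Φ χ z := by
      have h1 : ∀ a : X, Continuous fun χ : latticeCharacters e => χ.1 a := fun a =>
        (continuous_apply a).comp continuous_subtype_val
      exact Complex.equivRealProdCLM.symm.continuous.comp ((h1 z.re).prodMk (h1 z.im))
    have hcont' := (continuous_polarPow n).comp hcont
    obtain ⟨a, ha⟩ := exists_forall_latticeCharacters_eq he hunit harch hcomplete
      ⟨_, Complex.continuous_re.comp hcont'⟩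
    obtain ⟨b, hb⟩ := exists_forall_latticeCharacters_eq he hunit harch hcomplete
      ⟨_, Complex.continuous_im.comp hcont'⟩
    exact ⟨⟨a, b⟩, fun χ => Complex.ext (ha χ) (hb χ)⟩
  obtain ⟨j, w, hw, hjw⟩ := exists_biorthogonal Φ hli fun x _ hx => hsep x 0 fun χ => by
    rw [hx χ, map_zero]
  have hweig : ∀ b, Complexification.mapReal σ (w b) = μ • w b := by
    intro b
    have h1 : Submodule.span ℂ (Set.range h) ≤
        LinearMap.ker (Complexification.mapReal σ - μ • LinearMap.id) := by
      rw [Submodule.span_le]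
      rintro _ ⟨i, rfl⟩
      simp [heig]
    simpa [sub_eq_zero] using h1 (hw b)
  choose g hg using fun b => hpow (w b)
  refine ⟨g, ?_, fun b => hsep _ _ fun χ => ?_⟩
  · rw [Fintype.linearIndependent_iff]
    intro c hc a
    have h1 := congrArg (Φ (j a)) hc
    simpa [hg, hjw, apply_ite (polarPow n), polarPow_one, polarPow_zero] using h1
  · obtain ⟨ψ, hψ⟩ := hcomp χ
    rw [hψ, hg, ← hψ, hweig, map_smul, map_smul, hg, smul_eq_mul, smul_eq_mul, polarPow_mul hμ]

/-! ### The vector lattice of backward orbits -/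

theorem ContinuousLinearMap.mono_of_nonneg {F : Type u} [NormedAddCommGroup F] [Lattice F]
    [IsOrderedAddMonoid F] [NormedSpace ℝ F] {S : F →L[ℝ] F} (hS : ∀ x, 0 ≤ x → 0 ≤ S x)
    {a b : F} (hab : a ≤ b) : S a ≤ S b := by
  rw [← sub_nonneg, ← map_sub]
  exact hS _ (sub_nonneg.2 hab)

theorem ContinuousLinearMap.pow_succ_apply {F : Type u} [NormedAddCommGroup F] [NormedSpace ℝ F]
    (S : F →L[ℝ] F) (m : ℕ) (a : F) : (S ^ (m + 1)) a = (S ^ m) (S a) := by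
  rw [pow_succ, mul_apply_eq_comp]

theorem ContinuousLinearMap.pow_mono_of_nonneg {F : Type u} [NormedAddCommGroup F] [Lattice F]
    [IsOrderedAddMonoid F] [NormedSpace ℝ F] {S : F →L[ℝ] F} (hS : ∀ x, 0 ≤ x → 0 ≤ S x) (m : ℕ)
    {a b : F} (hab : a ≤ b) : (S ^ m) a ≤ (S ^ m) b := by
  induction m generalizing a b with
  | zero => simpa
  | succ m ih =>
    rw [pow_succ_apply, pow_succ_apply]
    exact ih (mono_of_nonneg hS hab)

theorem ContinuousLinearMap.pow_apply_fixed {F : Type u} [NormedAddCommGroup F] [NormedSpace ℝ F]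
    {S : F →L[ℝ] F} {y : F} (hy : S y = y) (m : ℕ) : (S ^ m) y = y := by
  induction m with
  | zero => simp
  | succ m ih => rw [pow_succ_apply, hy, ih]

theorem IsKBSpace.exists_tendsto_of_le {F : Type u} [NormedAddCommGroup F] [Lattice F]
    [HasSolidNorm F] [IsOrderedAddMonoid F] (hKB : IsKBSpace F) {p : ℕ → F} (hp : Monotone p)
    {b : F} (hb : ∀ n, p n ≤ b) : ∃ l, Tendsto p atTop (𝓝 l) := by
  obtain ⟨l, hl⟩ := hKB (fun n => p n - p 0) (fun m n h => sub_le_sub_right (hp h) _)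
    (fun n => sub_nonneg.2 (hp (Nat.zero_le n))) ⟨‖b - p 0‖, fun n => by
      refine norm_le_norm_of_abs_le_abs ?_
      rw [abs_of_nonneg (sub_nonneg.2 (hp (Nat.zero_le n)))]
      exact (sub_le_sub_right (hb n) _).trans (le_abs_self _)⟩
  exact ⟨l + p 0, by simpa using hl.add_const (p 0)⟩

theorem le_zero_of_forall_le_smul {F : Type u} [NormedAddCommGroup F] [Lattice F] [HasSolidNorm F]
    [IsOrderedAddMonoid F] [NormedSpace ℝ F] {a y : F}
    (h : ∀ ε : ℝ, 0 < ε → a ≤ ε • y) : a ≤ 0 := by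
  have h1 : Tendsto (fun n : ℕ => (1 / ((n : ℝ) + 1)) • y) atTop (𝓝 0) := by
    simpa using (tendsto_one_div_add_atTop_nhds_zero_nat (𝕜 := ℝ)).smul_const y
  exact ge_of_tendsto' h1 fun n => h _ (by positivity)

section OrbitSpace

variable {F : Type u} [NormedAddCommGroup F] [Lattice F] [HasSolidNorm F] [IsOrderedAddMonoid F]
  [NormedSpace ℝ F] [IsOrderedModule ℝ F]

/-- The backward orbits of `S`, i.e. the sequences `x` with `S (x (k + 1)) = x k`, that are
contained in a multiple of the order interval `[-y, y]`; they are ordered pointwise. -/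
def orbitSpace (S : F →L[ℝ] F) (y : F) : Submodule ℝ (ℕ → F) where
  carrier := {x | (∀ k, S (x (k + 1)) = x k) ∧ ∃ c : ℝ, ∀ k, |x k| ≤ c • y}
  zero_mem' := ⟨by simp, 0, by simp⟩
  add_mem' := by
    rintro a b ⟨ha, c, hc⟩ ⟨hb, d, hd⟩
    refine ⟨fun k => by simp [ha, hb], c + d, fun k => ?_⟩
    rw [add_smul]
    exact (abs_add_le _ _).trans (add_le_add (hc k) (hd k))
  smul_mem' := by
    rintro r a ⟨ha, c, hc⟩
    refine ⟨fun k => by simp [ha], |r| * c, fun k => ?_⟩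
    rw [mul_smul]
    have h1 := smul_le_smul_of_nonneg_left (hc k) (abs_nonneg r)
    refine abs_le'.2 ⟨(Complexification.smul_le_smul_abs _ _ le_rfl _).trans h1, ?_⟩
    rw [Pi.smul_apply, ← neg_smul]
    exact (Complexification.smul_le_smul_abs _ _ (abs_neg r).le _).trans h1

instance (S : F →L[ℝ] F) (y : F) : IsOrderedModule ℝ (orbitSpace S y) where
  smul_le_smul_of_nonneg_left _ hc _ _ hab k := smul_le_smul_of_nonneg_left (hab k) hc
  smul_le_smul_of_nonneg_right _ ha _ _ hcd k := smul_le_smul_of_nonneg_right hcd (ha k)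

theorem orbitSpace_pow_apply {S : F →L[ℝ] F} {y : F} (x : orbitSpace S y) (k m : ℕ) :
    (S ^ m) (x.1 (k + m)) = x.1 k := by
  induction m with
  | zero => simp
  | succ m ih => rw [ContinuousLinearMap.pow_succ_apply, ← add_assoc, x.2.1, ih]

/-- The supremum of two backward orbits is `k ↦ lim_m S ^ m (a (k + m) ⊔ b (k + m))`; the sequence
is increasing by positivity of `S` and bounded by a multiple of the fixed point `y`. -/
theorem orbitSpace_exists_sup (hKB : IsKBSpace F) {S : F →L[ℝ] F} (hS : ∀ x, 0 ≤ x → 0 ≤ S x)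
    {y : F} (hy : 0 ≤ y) (hSy : S y = y) (a b : orbitSpace S y) :
    ∃ c : orbitSpace S y, a ≤ c ∧ b ≤ c ∧ ∀ d, a ≤ d → b ≤ d → c ≤ d := by
  obtain ⟨ca, hca⟩ := a.2.2
  obtain ⟨cb, hcb⟩ := b.2.2
  set c := max ca cb
  have hac : ∀ k, |a.1 k| ≤ c • y := fun k =>
    (hca k).trans (smul_le_smul_of_nonneg_right (le_max_left _ _) hy)
  have hbc : ∀ k, |b.1 k| ≤ c • y := fun k =>
    (hcb k).trans (smul_le_smul_of_nonneg_right (le_max_right _ _) hy)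
  set p : ℕ → ℕ → F := fun k m => (S ^ m) (a.1 (k + m) ⊔ b.1 (k + m)) with hp
  have hpow : ∀ (m : ℕ) {u v : F}, u ≤ v → (S ^ m) u ≤ (S ^ m) v := fun m u v h =>
    ContinuousLinearMap.pow_mono_of_nonneg hS m h
  have hmono : ∀ k, Monotone (p k) := fun k => monotone_nat_of_le_succ fun m => by
    simp only [hp, ContinuousLinearMap.pow_succ_apply]
    refine hpow m (sup_le ?_ ?_)
    · rw [← a.2.1 (k + m)]
      exact ContinuousLinearMap.mono_of_nonneg hS le_sup_left
    · rw [← b.2.1 (k + m)]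
      exact ContinuousLinearMap.mono_of_nonneg hS le_sup_right
  have hbound : ∀ k m, p k m ≤ c • y := by
    intro k m
    have h1 : (S ^ m) (c • y) = c • y := by
      rw [map_smul, ContinuousLinearMap.pow_apply_fixed hSy]
    rw [← h1]
    exact hpow m (sup_le ((le_abs_self _).trans (hac _)) ((le_abs_self _).trans (hbc _)))
  choose l hl using fun k => hKB.exists_tendsto_of_le (hmono k) (hbound k)
  have hal : ∀ k, a.1 k ≤ l k := fun k => ge_of_tendsto' (hl k) fun m => by
    rw [← orbitSpace_pow_apply a k m]
    exact hpow m le_sup_left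
  have hbl : ∀ k, b.1 k ≤ l k := fun k => ge_of_tendsto' (hl k) fun m => by
    rw [← orbitSpace_pow_apply b k m]
    exact hpow m le_sup_right
  refine ⟨⟨l, fun k => ?_, c, fun k => abs_le'.2 ⟨le_of_tendsto' (hl k) (hbound k), ?_⟩⟩, hal, hbl,
    fun d had hbd k => le_of_tendsto' (hl k) fun m => ?_⟩
  · have h1 : Tendsto (fun m => S (p (k + 1) m)) atTop (𝓝 (S (l (k + 1)))) :=
      (S.continuous.tendsto _).comp (hl (k + 1))
    have h2 : ∀ m, S (p (k + 1) m) = p k (m + 1) := fun m => by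
      simp only [hp, pow_succ', mul_apply_eq_comp]
      rw [add_right_comm, add_assoc]
    simp only [h2] at h1
    exact tendsto_nhds_unique h1 ((hl k).comp (tendsto_add_atTop_nat 1))
  · exact (neg_le_neg (hal k)).trans ((neg_le_abs _).trans (hac k))
  · rw [← orbitSpace_pow_apply d k m]
    exact hpow m (sup_le (had _) (hbd _))

/-- The vector lattice structure of the space of backward orbits. -/
noncomputable abbrev orbitLattice (hKB : IsKBSpace F) {S : F →L[ℝ] F} (hS : ∀ x, 0 ≤ x → 0 ≤ S x)
    {y : F} (hy : 0 ≤ y) (hSy : S y = y) : Lattice (orbitSpace S y) :=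
  { (inferInstance : PartialOrder (orbitSpace S y)) with
    sup := fun a b => (orbitSpace_exists_sup hKB hS hy hSy a b).choose
    le_sup_left := fun a b => (orbitSpace_exists_sup hKB hS hy hSy a b).choose_spec.1
    le_sup_right := fun a b => (orbitSpace_exists_sup hKB hS hy hSy a b).choose_spec.2.1
    sup_le := fun a b c => (orbitSpace_exists_sup hKB hS hy hSy a b).choose_spec.2.2 c
    inf := fun a b => -(orbitSpace_exists_sup hKB hS hy hSy (-a) (-b)).choose
    inf_le_left := fun a b =>
      neg_le.1 (orbitSpace_exists_sup hKB hS hy hSy (-a) (-b)).choose_spec.1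
    inf_le_right := fun a b =>
      neg_le.1 (orbitSpace_exists_sup hKB hS hy hSy (-a) (-b)).choose_spec.2.1
    le_inf := fun a b c hab hac =>
      le_neg.1 ((orbitSpace_exists_sup hKB hS hy hSy (-b) (-c)).choose_spec.2.2 (-a)
        (neg_le_neg hab) (neg_le_neg hac)) }

/-- The constant orbit of a fixed point. -/
def orbitUnit {S : F →L[ℝ] F} {y : F} (hy : 0 ≤ y) (hSy : S y = y) : orbitSpace S y :=
  ⟨fun _ => y, fun _ => hSy, 1, fun _ => by rw [one_smul, abs_of_nonneg hy]⟩

/-- The action of `S` on its backward orbits. -/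
def orbitShift {S : F →L[ℝ] F} (hS : ∀ x, 0 ≤ x → 0 ≤ S x) {y : F} (hSy : S y = y) :
    orbitSpace S y →ₗ[ℝ] orbitSpace S y where
  toFun x := ⟨fun k => S (x.1 k), fun k => congrArg S (x.2.1 k), by
    obtain ⟨c, hc⟩ := x.2.2
    have h1 : S (c • y) = c • y := by rw [map_smul, hSy]
    refine ⟨c, fun k => abs_le'.2 ⟨?_, ?_⟩⟩
    · rw [← h1]
      exact ContinuousLinearMap.mono_of_nonneg hS ((le_abs_self _).trans (hc k))
    · rw [← h1, ← map_neg]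
      exact ContinuousLinearMap.mono_of_nonneg hS ((neg_le_abs _).trans (hc k))⟩
  map_add' a b := Subtype.ext (funext fun k => map_add S _ _)
  map_smul' r a := Subtype.ext (funext fun k => map_smul S _ _)

/-- `S` is an order automorphism of the space of its backward orbits: its inverse drops the initial
term of an orbit. -/
def orbitShiftIso {S : F →L[ℝ] F} (hS : ∀ x, 0 ≤ x → 0 ≤ S x) {y : F} (hSy : S y = y) :
    orbitSpace S y ≃o orbitSpace S y where
  toFun := orbitShift hS hSy
  invFun x := ⟨fun k => x.1 (k + 1), fun k => x.2.1 (k + 1), x.2.2.imp fun c hc k => hc (k + 1)⟩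
  left_inv x := Subtype.ext (funext fun k => x.2.1 k)
  right_inv x := Subtype.ext (funext fun k => x.2.1 k)
  map_rel_iff' := by
    intro a b
    refine ⟨fun h k => ?_, fun h k => ContinuousLinearMap.mono_of_nonneg hS (h k)⟩
    rw [← a.2.1 k, ← b.2.1 k]
    exact h (k + 1)

theorem orbitSpace_le_unit {S : F →L[ℝ] F} {y : F} (hy : 0 ≤ y) (hSy : S y = y)
    (a : orbitSpace S y) : ∃ c : ℝ, a ≤ c • orbitUnit hy hSy :=
  a.2.2.imp fun _ hc k => (le_abs_self _).trans (hc k)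

/-- The space of backward orbits is complete for the gauge norm of `y`: Cauchy sequences converge
pointwise, because the norm of `F` is solid and `F` is complete. -/
theorem orbitSpace_complete [CompleteSpace F] {S : F →L[ℝ] F} {y : F} (hy : 0 ≤ y) (hSy : S y = y)
    (a : ℕ → orbitSpace S y)
    (ha : ∀ ε : ℝ, 0 < ε → ∃ N, ∀ m ≥ N, ∀ n ≥ N, a m ≤ a n + ε • orbitUnit hy hSy) :
    ∃ l : orbitSpace S y, ∀ ε : ℝ, 0 < ε → ∃ N, ∀ n ≥ N,
      a n ≤ l + ε • orbitUnit hy hSy ∧ l ≤ a n + ε • orbitUnit hy hSy := by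
  have hcau : ∀ k, CauchySeq fun n => (a n).1 k := by
    intro k
    refine Metric.cauchySeq_iff.2 fun δ hδ => ?_
    obtain ⟨N, hN⟩ := ha (δ / (2 * (‖y‖ + 1))) (by positivity)
    refine ⟨N, fun m hm n hn => ?_⟩
    set ε := δ / (2 * (‖y‖ + 1)) with hε
    have hε0 : 0 ≤ ε := by positivity
    have h1 : |(a m).1 k - (a n).1 k| ≤ |ε • y| := by
      rw [abs_of_nonneg (smul_nonneg hε0 hy)]
      refine abs_le'.2 ⟨sub_le_iff_le_add'.2 (hN m hm n hn k), ?_⟩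
      rw [neg_sub]
      exact sub_le_iff_le_add'.2 (hN n hn m hm k)
    rw [dist_eq_norm]
    refine (norm_le_norm_of_abs_le_abs h1).trans_lt ?_
    rw [norm_smul, Real.norm_of_nonneg hε0, hε, div_mul_eq_mul_div, div_lt_iff₀ (by positivity)]
    nlinarith [norm_nonneg y]
  choose l hl using fun k => cauchySeq_tendsto_of_complete (hcau k)
  have key : ∀ ε : ℝ, 0 < ε → ∃ N, ∀ n ≥ N, ∀ k,
      (a n).1 k ≤ l k + ε • y ∧ l k ≤ (a n).1 k + ε • y := by
    intro ε hε
    obtain ⟨N, hN⟩ := ha ε hε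
    refine ⟨N, fun n hn k => ⟨?_, ?_⟩⟩
    · exact ge_of_tendsto ((hl k).add_const (ε • y))
        ((eventually_ge_atTop N).mono fun m hm => hN n hn m hm k)
    · exact le_of_tendsto (hl k) ((eventually_ge_atTop N).mono fun m hm => hN m hm n hn k)
  refine ⟨⟨l, fun k => ?_, ?_⟩, fun ε hε => ?_⟩
  · have h1 : Tendsto (fun n => S ((a n).1 (k + 1))) atTop (𝓝 (S (l (k + 1)))) :=
      (S.continuous.tendsto _).comp (hl (k + 1))
    simp only [fun n => (a n).2.1 k] at h1
    exact tendsto_nhds_unique h1 (hl k)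
  · obtain ⟨N, hN⟩ := key 1 one_pos
    obtain ⟨c, hc⟩ := (a N).2.2
    refine ⟨c + 1, fun k => abs_le'.2 ⟨?_, ?_⟩⟩
    · rw [add_smul]
      exact (hN N le_rfl k).2.trans (add_le_add_left ((le_abs_self _).trans (hc k)) _)
    · rw [add_smul, neg_le_iff_add_nonneg]
      have h1 := (hN N le_rfl k).1
      have h2 := (neg_le_abs ((a N).1 k)).trans (hc k)
      calc (0 : F) = -(a N).1 k + (a N).1 k := by abel
        _ ≤ c • y + (l k + (1 : ℝ) • y) := add_le_add h2 h1
        _ = _ := by abel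
  · obtain ⟨N, hN⟩ := key ε hε
    exact ⟨N, fun n hn => ⟨fun k => (hN n hn k).1, fun k => (hN n hn k).2⟩⟩

/-- Evaluation of complex backward orbits at time `k`. -/
def orbitEval (S : F →L[ℝ] F) (y : F) (k : ℕ) :
    Complexification (orbitSpace S y) →ₗ[ℂ] Complexification F :=
  Complexification.mapReal ((LinearMap.proj k).comp (orbitSpace S y).subtype)

/-- Linearly independent eigenvectors of a positive operator for a unimodular eigenvalue `μ`, all
dominated by a positive fixed point, give as many linearly independent eigenvectors for `μ ^ n`:
an eigenvector `h` for `μ` has the backward orbit `μ⁻ᵏ h`, an eigenvector in the space of backward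
orbits, on which the operator is a lattice automorphism. -/
theorem exists_linearIndependent_eigenvectors_of_dominated [CompleteSpace F] (hKB : IsKBSpace F)
    {S : F →L[ℝ] F} (hS : ∀ x, 0 ≤ x → 0 ≤ S x) {y : F} (hy : 0 ≤ y) (hSy : S y = y)
    {μ : ℂ} (hμ : ‖μ‖ = 1) (n : ℤ) {m : ℕ} {h : Fin m → Complexification F}
    (hli : LinearIndependent ℂ h)
    (heig : ∀ i, Complexification.mapReal (S : F →ₗ[ℝ] F) (h i) = μ • h i)
    (hdom : ∀ i, (h i).modulus ≤ y) :
    ∃ g : Fin m → Complexification F, LinearIndependent ℂ g ∧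
      ∀ i, Complexification.mapReal (S : F →ₗ[ℝ] F) (g i) = μ ^ n • g i := by
  have hμ0 : μ ≠ 0 := norm_ne_zero_iff.1 (by rw [hμ]; exact one_ne_zero)
  let w : Fin m → ℕ → Complexification F := fun i k => (μ⁻¹) ^ k • h i
  have hw : ∀ i k, Complexification.mapReal (S : F →ₗ[ℝ] F) (w i (k + 1)) = w i k := by
    intro i k
    simp only [w, map_smul, heig, smul_smul]
    rw [pow_succ, mul_assoc, inv_mul_cancel₀ hμ0, mul_one]
  have hwy : ∀ i k, (w i k).modulus ≤ (1 : ℝ) • y := by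
    intro i k
    refine (Complexification.modulus_smul_le _ _).trans ?_
    rw [norm_pow, norm_inv, hμ, inv_one, one_pow]
    exact smul_le_smul_of_nonneg_left (hdom i) zero_le_one
  let H : Fin m → Complexification (orbitSpace S y) := fun i =>
    ⟨⟨fun k => (w i k).re, fun k => congrArg Complexification.re (hw i k), 1, fun k =>
        (Complexification.abs_re_le_modulus _).trans (hwy i k)⟩,
      ⟨fun k => (w i k).im, fun k => congrArg Complexification.im (hw i k), 1, fun k =>
        (Complexification.abs_im_le_modulus _).trans (hwy i k)⟩⟩
  have hext : ∀ Z W : Complexification (orbitSpace S y),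
      (∀ k, orbitEval S y k Z = orbitEval S y k W) → Z = W := fun Z W hZW =>
    Complexification.ext (Subtype.ext (funext fun k => congrArg Complexification.re (hZW k)))
      (Subtype.ext (funext fun k => congrArg Complexification.im (hZW k)))
  have hHw : ∀ i k, orbitEval S y k (H i) = w i k := fun i k => rfl
  set σ := orbitShift hS hSy
  have hσS : ∀ Z k, orbitEval S y k (Complexification.mapReal σ Z) =
      Complexification.mapReal (S : F →ₗ[ℝ] F) (orbitEval S y k Z) := fun Z k => rfl
  have hHli : LinearIndependent ℂ H := by
    refine LinearIndependent.of_comp (orbitEval S y 0) ?_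
    convert hli using 1
    funext i
    simp [hHw, w]
  have hHeig : ∀ i, Complexification.mapReal σ (H i) = μ • H i := fun i => hext _ _ fun k => by
    rw [hσS, hHw, map_smul (orbitEval S y k), hHw]
    simp only [w, map_smul, heig]
    rw [smul_comm]
  let _ : Lattice (orbitSpace S y) := orbitLattice hKB hS hy hSy
  obtain ⟨G, hGli, hGeig⟩ := exists_linearIndependent_eigenvectors (e := orbitUnit hy hSy)
    (fun k => hy) (orbitSpace_le_unit hy hSy)
    (fun a ha k => le_zero_of_forall_le_smul fun ε hε => ha ε hε k)
    (orbitSpace_complete hy hSy) (σ := σ) (fun a b => (orbitShiftIso hS hSy).map_sup a b)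
    (Subtype.ext (funext fun k => hSy)) hμ n hHli hHeig
  refine ⟨fun i => orbitEval S y 0 (G i), ?_, fun i => by rw [← hσS, hGeig, map_smul]⟩
  rw [Fintype.linearIndependent_iff]
  intro c hc
  refine Fintype.linearIndependent_iff.1 hGli c (hext _ _ fun k => ?_)
  set Z := ∑ i, c i • G i with hZ
  have hZeig : Complexification.mapReal σ Z = μ ^ n • Z := by
    simp only [hZ, map_sum, map_smul, hGeig, Finset.smul_sum]
    exact Finset.sum_congr rfl fun i _ => smul_comm _ _ _
  -- the entry at time `k` of an eigenorbit is a multiple of its entry at time `k + 1`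
  have hstep : ∀ k, orbitEval S y k Z = μ ^ n • orbitEval S y (k + 1) Z := by
    intro k
    rw [← map_smul, ← hZeig]
    exact Complexification.ext (Z.re.2.1 k).symm (Z.im.2.1 k).symm
  rw [map_zero]
  induction k with
  | zero => simpa [hZ] using hc
  | succ k ih => exact (smul_eq_zero_iff_right (zpow_ne_zero n hμ0)).1 ((hstep k).symm.trans ih)

end OrbitSpace

/-! ### Analytic functions of an operator of spectral radius one -/

theorem AnalyticOnNhd.exists_hasSum_taylor {f : ℂ → ℂ}
    (hf : AnalyticOnNhd ℂ f (Metric.closedBall 0 1)) :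
    ∃ R : ℝ, 1 < R ∧ ∀ z : ℂ, ‖z‖ < R →
      HasSum (fun k : ℕ => iteratedDeriv k f 0 / (k.factorial : ℂ) * z ^ k) (f z) := by
  obtain ⟨δ, hδ, hsub⟩ := (isCompact_closedBall (0 : ℂ) 1).exists_cthickening_subset_open
    (isOpen_analyticAt ℂ f) hf
  rw [cthickening_closedBall hδ.le zero_le_one] at hsub
  refine ⟨δ + 1, by linarith, fun z hz => ?_⟩
  have hd : DifferentiableOn ℂ f (Metric.ball 0 (δ + 1)) := fun x hx =>
    (hsub (Metric.ball_subset_closedBall hx)).differentiableAt.differentiableWithinAt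
  have h1 := Complex.hasSum_taylorSeries_on_ball hd (z := z) (by simpa using hz)
  have h2 : (fun k : ℕ => (k.factorial : ℂ)⁻¹ • (z - 0) ^ k • iteratedDeriv k f 0) =
      fun k : ℕ => iteratedDeriv k f 0 / (k.factorial : ℂ) * z ^ k := by
    funext k
    rw [sub_zero, smul_eq_mul, smul_eq_mul]
    ring
  rwa [h2] at h1

theorem eventually_norm_pow_le_of_spectralRadius_lt {A : Type*} [NormedRing A] [NormedAlgebra ℂ A]
    [CompleteSpace A] {a : A} {ρ : ℝ} (ha : spectralRadius ℂ a < ENNReal.ofReal ρ) :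
    ∀ᶠ k : ℕ in atTop, ‖a ^ k‖ ≤ ρ ^ k := by
  filter_upwards [(spectrum.pow_norm_pow_one_div_tendsto_nhds_spectralRadius a).eventually_lt_const
    ha, eventually_gt_atTop 0] with k hk hk0
  have h1 : ‖a ^ k‖ ^ (1 / k : ℝ) < ρ :=
    (ENNReal.ofReal_lt_ofReal_iff_of_nonneg (by positivity)).1 hk
  have h2 := pow_le_pow_left₀ (by positivity) h1.le k
  rwa [one_div, Real.rpow_inv_natCast_pow (norm_nonneg _) hk0.ne'] at h2

/-- By Gelfand's formula `‖T ^ k‖` grows slower than `ρ ^ k` for each `ρ > 1`, while the Taylor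
series of `f` converges absolutely at some `ρ > 1`. -/
theorem hasSum_analyticCalculus {X : Type u} [NormedAddCommGroup X] [NormedSpace ℂ X]
    [CompleteSpace X] {T : X →L[ℂ] X} (hT : spectralRadius ℂ T ≤ 1) {f : ℂ → ℂ}
    (hf : AnalyticOnNhd ℂ f (Metric.closedBall 0 1)) :
    HasSum (fun k : ℕ => (iteratedDeriv k f 0 / (k.factorial : ℂ)) • T ^ k)
      (analyticCalculus f T) := by
  obtain ⟨R, hR, hsum⟩ := hf.exists_hasSum_taylor
  obtain ⟨ρ, hρ1, hρR⟩ := exists_between hR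
  have hρ0 : 0 ≤ ρ := by linarith
  have h1 := (hsum ρ (by rwa [Complex.norm_real, Real.norm_of_nonneg hρ0])).summable.norm
  have h2 := eventually_norm_pow_le_of_spectralRadius_lt
    (hT.trans_lt (by simpa using hρ1) : spectralRadius ℂ T < ENNReal.ofReal ρ)
  refine (Summable.of_norm_bounded_eventually_nat h1 ?_).hasSum
  filter_upwards [h2] with k hk
  rw [norm_smul, norm_mul, norm_pow (ρ : ℂ), Complex.norm_real, Real.norm_of_nonneg hρ0]
  gcongr

/-! ### Positive fixed points above subinvariant vectors -/

theorem Complexification.ofReal_smul {F : Type u} [AddCommGroup F] [Module ℝ F] (c : ℝ) (x : F) :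
    ofReal (c • x) = (c : ℂ) • ofReal x := by
  apply Complexification.ext
  · rw [smul_re, Complex.ofReal_re, Complex.ofReal_im, zero_smul, sub_zero]
    rfl
  · rw [smul_im, Complex.ofReal_re, Complex.ofReal_im, zero_smul, zero_add]
    exact (smul_zero c).symm

section FixedPoint

variable {F : Type u} [NormedAddCommGroup F] [Lattice F] [HasSolidNorm F] [IsOrderedAddMonoid F]
  [NormedSpace ℝ F] [IsOrderedModule ℝ F] [CompleteSpace F]

/-- The restriction of a positive operator to the real part of the complex Banach lattice. -/
noncomputable def realRestriction (T : Complexification F →L[ℂ] Complexification F) : F →L[ℝ] F :=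
  LinearMap.mkContinuous
    { toFun := fun x => (T (Complexification.ofReal x)).re
      map_add' := fun x y => by
        have h : Complexification.ofReal (x + y) =
            Complexification.ofReal x + Complexification.ofReal y := by
          ext <;> simp [Complexification.ofReal]
        rw [h, map_add, Complexification.add_re]
      map_smul' := fun c x => by
        rw [Complexification.ofReal_smul, map_smul, Complexification.smul_re, Complex.ofReal_re,
          Complex.ofReal_im, zero_smul, sub_zero, RingHom.id_apply] } ‖T‖
    fun x => (Complexification.norm_re_le _).trans
      ((T.le_opNorm _).trans_eq (by rw [Complexification.norm_ofReal]))

variable {T : Complexification F →L[ℂ] Complexification F}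

theorem IsPositiveOperator.realRestriction_nonneg (hT : IsPositiveOperator T) (x : F) (hx : 0 ≤ x) :
    0 ≤ realRestriction T x := by
  obtain ⟨y, hy, hxy⟩ := hT x hx
  change 0 ≤ (T (Complexification.ofReal x)).re
  rwa [hxy]

theorem IsPositiveOperator.apply_ofReal (hT : IsPositiveOperator T) (x : F) :
    T (Complexification.ofReal x) = Complexification.ofReal (realRestriction T x) := by
  have h : Complexification.ofReal x =
      Complexification.ofReal x⁺ - Complexification.ofReal x⁻ := by
    ext <;> simp [Complexification.ofReal]
  obtain ⟨y, -, hy⟩ := hT x⁺ (posPart_nonneg x)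
  obtain ⟨z, -, hz⟩ := hT x⁻ (negPart_nonneg x)
  refine Complexification.ext rfl ?_
  rw [h, map_sub, hy, hz]
  simp [Complexification.ofReal]

theorem IsPositiveOperator.apply_eq_mapReal (hT : IsPositiveOperator T) (z : Complexification F) :
    T z = Complexification.mapReal (realRestriction T : F →ₗ[ℝ] F) z := by
  have h : ∀ x y : F, (⟨x, y⟩ : Complexification F) =
      Complexification.ofReal x + Complex.I • Complexification.ofReal y := fun x y => by
    ext <;> simp [Complexification.ofReal]
  change T ⟨z.re, z.im⟩ = ⟨realRestriction T z.re, realRestriction T z.im⟩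
  rw [h, h, map_add, map_smul, hT.apply_ofReal, hT.apply_ofReal]

theorem IsPositiveOperator.modulus_apply_le (hT : IsPositiveOperator T) (z : Complexification F) :
    (T z).modulus ≤ realRestriction T z.modulus := by
  refine Complexification.modulus_le fun θ => ?_
  have h := ContinuousLinearMap.mono_of_nonneg hT.realRestriction_nonneg
    (Complexification.le_modulus z θ)
  rw [map_add, map_smul, map_smul] at h
  rwa [hT.apply_eq_mapReal]

theorem IsPositiveOperator.modulus_le_of_eigenvector (hT : IsPositiveOperator T)
    {z : Complexification F} {μ : ℂ} (hμ : ‖μ‖ = 1) (hz : T z = μ • z) :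
    z.modulus ≤ realRestriction T z.modulus := by
  have hμ0 : μ ≠ 0 := norm_ne_zero_iff.1 (by rw [hμ]; exact one_ne_zero)
  have h := Complexification.modulus_smul_le μ⁻¹ (μ • z)
  rw [inv_smul_smul₀ hμ0, norm_inv, hμ, inv_one, one_smul, ← hz] at h
  exact h.trans (hT.modulus_apply_le z)

theorem IsPositiveOperator.pow_apply_ofReal (hT : IsPositiveOperator T) (k : ℕ) (x : F) :
    (T ^ k) (Complexification.ofReal x) = Complexification.ofReal ((realRestriction T ^ k) x) := by
  induction k with
  | zero => simp
  | succ k ih => rw [pow_succ', pow_succ', mul_apply_eq_comp, mul_apply_eq_comp, ih,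
      hT.apply_ofReal]

theorem Complexification.continuous_re :
    Continuous (Complexification.re : Complexification F → F) :=
  AddMonoidHomClass.continuous_of_bound
    (AddMonoidHom.mk' (Complexification.re : Complexification F → F) fun _ _ => rfl) 1 fun z => by
      rw [one_mul]
      exact Complexification.norm_re_le z

/-- If the power series `f` has non-negative coefficients `a k`, then `f(T) w` dominates
`(∑ k ≥ N, a k) • T ^ N w` for every positive vector `w ≤ T w`. -/
theorem IsPositiveOperator.smul_pow_le_analyticCalculus (hT : IsPositiveOperator T)
    (hr : spectralRadius ℂ T ≤ 1) {f : ℂ → ℂ}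
    (hf : AnalyticOnNhd ℂ f (Metric.closedBall 0 1)) (hf1 : f 1 = 1)
    (hf0 : ∀ k, 0 ≤ (iteratedDeriv k f 0).re ∧ (iteratedDeriv k f 0).im = 0)
    {w : F} (hw : 0 ≤ w) (hTw : w ≤ realRestriction T w) (N : ℕ) :
    (1 - N * (2 ^ N * (f (1 / 2)).re)) • (realRestriction T ^ N) w ≤
      (analyticCalculus f T (Complexification.ofReal w)).re := by
  set S := realRestriction T
  have hSpow : ∀ k, 0 ≤ (S ^ k) w := fun k => by
    simpa using ContinuousLinearMap.pow_mono_of_nonneg hT.realRestriction_nonneg k hw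
  have hmono : Monotone fun k => (S ^ k) w := monotone_nat_of_le_succ fun k => by
    rw [ContinuousLinearMap.pow_succ_apply]
    exact ContinuousLinearMap.pow_mono_of_nonneg hT.realRestriction_nonneg k hTw
  set c : ℕ → ℝ := fun k => (iteratedDeriv k f 0).re / k.factorial with hc
  have hc0 : ∀ k, 0 ≤ c k := fun k => div_nonneg (hf0 k).1 (by positivity)
  have hcoe : ∀ k, iteratedDeriv k f 0 / (k.factorial : ℂ) = (c k : ℂ) := fun k => by
    have h : iteratedDeriv k f 0 = ((iteratedDeriv k f 0).re : ℂ) :=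
      Complex.ext (by simp) (by simp [(hf0 k).2])
    rw [h]
    simp [hc]
  obtain ⟨R, hR, hsum⟩ := hf.exists_hasSum_taylor
  simp only [hcoe] at hsum
  have hreal : ∀ x : ℝ, ‖(x : ℂ)‖ < R → HasSum (fun k => c k * x ^ k) (f x).re := fun x hx => by
    have h := Complex.hasSum_re (hsum x hx)
    simpa only [← Complex.ofReal_pow, ← Complex.ofReal_mul, Complex.ofReal_re] using h
  have hsum1 : HasSum c 1 := by
    have h := hreal 1 (by simpa using hR)
    simpa [hf1] using h
  -- the single term `c k * (1 / 2) ^ k` is at most the value of the series at `1 / 2`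
  have hsmall : ∀ k < N, c k ≤ 2 ^ N * (f (1 / 2)).re := by
    intro k hk
    have h := hreal (1 / 2) (by
      rw [Complex.norm_real, Real.norm_of_nonneg (by norm_num)]
      linarith)
    have h1 := h.tsum_eq ▸ h.summable.le_tsum k fun i _ => mul_nonneg (hc0 i) (by positivity)
    have h2 : c k * (1 / 2) ^ N ≤ c k * (1 / 2) ^ k :=
      mul_le_mul_of_nonneg_left (pow_le_pow_of_le_one (by norm_num) (by norm_num) hk.le) (hc0 k)
    have h3 : c k = 2 ^ N * (c k * (1 / 2) ^ N) := by
      rw [mul_left_comm, ← mul_pow]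
      norm_num
    rw [h3]
    have h4 : ((1 / 2 : ℝ) : ℂ) = 1 / 2 := by norm_num
    rw [h4] at h1
    exact mul_le_mul_of_nonneg_left (h2.trans h1) (by positivity)
  have hhead : ∑ k ∈ Finset.range N, c k ≤ N * (2 ^ N * (f (1 / 2)).re) := by
    have h := Finset.sum_le_card_nsmul (Finset.range N) c _ fun k hk =>
      hsmall k (Finset.mem_range.1 hk)
    rwa [Finset.card_range, nsmul_eq_mul] at h
  have hA : HasSum (fun k => c k • (S ^ k) w)
      (analyticCalculus f T (Complexification.ofReal w)).re := by
    have h1 := (hasSum_analyticCalculus hr hf).mapL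
      (ContinuousLinearMap.apply ℂ (Complexification F) (Complexification.ofReal w))
    have h2 := h1.map (AddMonoidHom.mk' (Complexification.re : Complexification F → F)
      fun _ _ => rfl) Complexification.continuous_re
    have h3 : (fun k => c k • (S ^ k) w) = fun k =>
        ((iteratedDeriv k f 0 / (k.factorial : ℂ)) • (T ^ k) (Complexification.ofReal w)).re := by
      funext k
      rw [hcoe, hT.pow_apply_ofReal, ← Complexification.ofReal_smul]
      rfl
    rw [h3]
    exact h2
  -- the terms `b k • S ^ N w` are dominated by `c k • S ^ k w`, since `S ^ k w` increases with `k`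
  set b : ℕ → ℝ := fun k => if k < N then 0 else c k with hb
  have hbsum : HasSum b (1 - ∑ k ∈ Finset.range N, c k) := by
    have h1 : HasSum (fun k => if k < N then c k else 0) (∑ k ∈ Finset.range N, c k) := by
      rw [← Finset.sum_congr rfl fun k hk => if_pos (Finset.mem_range.1 hk)]
      exact hasSum_sum_of_ne_finset_zero fun k hk => if_neg (by simpa using hk)
    have h2 : b = fun k => c k - if k < N then c k else 0 := by
      funext k
      by_cases hk : k < N <;> simp [hb, hk]
    rw [h2]
    exact hsum1.sub h1
  refine (smul_le_smul_of_nonneg_right (by linarith) (hSpow N)).trans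
    (hasSum_le (fun k => ?_) (hbsum.smul_const ((S ^ N) w)) hA)
  by_cases hk : k < N
  · simpa [hb, hk] using smul_nonneg (hc0 k) (hSpow k)
  · simpa [hb, hk] using smul_le_smul_of_nonneg_left (hmono (not_lt.1 hk)) (hc0 k)

/-- Let `T` be (WS)-bounded and `0 ≤ w ≤ T w`.  The coefficients of a weighting scheme tend to
zero, so `f_j(T) w` eventually dominates `T ^ N w / 2`.  Hence the increasing sequence `T ^ N w` is
bounded, and its limit is a fixed point. -/
theorem IsPositiveOperator.exists_fixedPoint_ge (hKB : IsKBSpace F) (hT : IsPositiveOperator T)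
    (hr : spectralRadius ℂ T ≤ 1) (hWS : IsWSBounded.{u, v} T)
    {w : F} (hw : 0 ≤ w) (hTw : w ≤ realRestriction T w) :
    ∃ y, w ≤ y ∧ realRestriction T y = y := by
  obtain ⟨J, _, _, _, f, hf, C, hC⟩ := hWS
  set S := realRestriction T
  have hSpow : ∀ k, 0 ≤ (S ^ k) w := fun k => by
    simpa using ContinuousLinearMap.pow_mono_of_nonneg hT.realRestriction_nonneg k hw
  have hmono : Monotone fun k => (S ^ k) w := monotone_nat_of_le_succ fun k => by
    rw [ContinuousLinearMap.pow_succ_apply]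
    exact ContinuousLinearMap.pow_mono_of_nonneg hT.realRestriction_nonneg k hTw
  have hbound : ∀ N, ‖(S ^ N) w‖ ≤ 2 * (C * ‖w‖) := by
    intro N
    have hlim : Tendsto (fun j => 1 - N * (2 ^ N * (f j (1 / 2)).re)) atTop (𝓝 (1 : ℝ)) := by
      have h1 := (Complex.continuous_re.tendsto _).comp (hf.tendsto_zero (1 / 2) (by norm_num))
      have h2 := ((h1.const_mul (2 ^ N : ℝ)).const_mul (N : ℝ)).const_sub 1
      simpa using h2
    obtain ⟨j, hj⟩ := (hlim.eventually_const_lt (by norm_num : (1 / 2 : ℝ) < 1)).exists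
    have h1 := hT.smul_pow_le_analyticCalculus hr (hf.analytic j) (hf.map_one j) (hf.nonneg j) hw
      hTw N
    have h2 : (1 / 2 : ℝ) • (S ^ N) w ≤
        (analyticCalculus (f j) T (Complexification.ofReal w)).re :=
      (smul_le_smul_of_nonneg_right hj.le (hSpow N)).trans h1
    have h3 : ‖(1 / 2 : ℝ) • (S ^ N) w‖ ≤
        ‖(analyticCalculus (f j) T (Complexification.ofReal w)).re‖ := by
      refine norm_le_norm_of_abs_le_abs ?_
      rw [abs_of_nonneg (smul_nonneg (by norm_num) (hSpow N))]
      exact h2.trans (le_abs_self _)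
    have h4 := (Complexification.norm_re_le _).trans
      ((analyticCalculus (f j) T).le_of_opNorm_le (hC j) (Complexification.ofReal w))
    rw [Complexification.norm_ofReal] at h4
    rw [norm_smul, Real.norm_of_nonneg (by norm_num)] at h3
    linarith
  obtain ⟨y, hy⟩ := hKB _ hmono hSpow ⟨_, hbound⟩
  refine ⟨y, by simpa using hmono.ge_of_tendsto hy 0, ?_⟩
  have h1 : Tendsto (fun k => S ((S ^ k) w)) atTop (𝓝 (S y)) := (S.continuous.tendsto _).comp hy
  have h2 : ∀ k, S ((S ^ k) w) = (S ^ (k + 1)) w := fun k => by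
    rw [pow_succ', mul_apply_eq_comp]
  simp only [h2] at h1
  exact tendsto_nhds_unique h1 (hy.comp (tendsto_add_atTop_nat 1))

end FixedPoint

/-! ### Cyclicity of the peripheral point spectrum -/

theorem natCast_le_complexDim_iff {V : Type u} [AddCommGroup V] [Module ℂ V] {m : ℕ} :
    (m : ℕ∞) ≤ complexDim V ↔ ∃ v : Fin m → V, LinearIndependent ℂ v := by
  rw [complexDim, Cardinal.natCast_le_toENat, Module.le_rank_iff]

theorem mainTheorem3 {F : Type u} [NormedAddCommGroup F] [Lattice F] [HasSolidNorm F]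
    [IsOrderedAddMonoid F] [NormedSpace ℝ F] [IsOrderedModule ℝ F] [CompleteSpace F]
    (hKB : IsKBSpace F)
    (T : Complexification F →L[ℂ] Complexification F)
    (hpos : IsPositiveOperator T)
    (hr : spectralRadius ℂ T = 1)
    (hWS : IsWSBounded.{u, v} T) :
    (∀ (θ : ℝ) (n : ℤ),
      complexDim (LinearMap.ker ((Complex.exp (Complex.I * θ) •
          (1 : Complexification F →L[ℂ] Complexification F) - T).toLinearMap)) ≤
        complexDim (LinearMap.ker ((Complex.exp (Complex.I * n * θ) •
          (1 : Complexification F →L[ℂ] Complexification F) - T).toLinearMap))) ∧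
    IsCyclicSet (peripheralPointSpectrum T) := by
  have hnorm : ∀ t : ℝ, ‖Complex.exp (Complex.I * t)‖ = 1 := fun t => by
    rw [mul_comm]
    exact Complex.norm_exp_ofReal_mul_I t
  have hzpow : ∀ (θ : ℝ) (n : ℤ),
      Complex.exp (Complex.I * n * θ) = Complex.exp (Complex.I * θ) ^ n := fun θ n => by
    rw [← Complex.exp_int_mul]
    congr 1
    ring
  have hker : ∀ (μ : ℂ) (z : Complexification F),
      z ∈ LinearMap.ker ((μ • (1 : Complexification F →L[ℂ] Complexification F) -
        T).toLinearMap) ↔ T z = μ • z := fun μ z => by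
    rw [LinearMap.mem_ker]
    change μ • z - T z = 0 ↔ _
    rw [sub_eq_zero, eq_comm]
  have hdim : ∀ (θ : ℝ) (n : ℤ),
      complexDim (LinearMap.ker ((Complex.exp (Complex.I * θ) •
          (1 : Complexification F →L[ℂ] Complexification F) - T).toLinearMap)) ≤
        complexDim (LinearMap.ker ((Complex.exp (Complex.I * n * θ) •
          (1 : Complexification F →L[ℂ] Complexification F) - T).toLinearMap)) := by
    intro θ n
    refine ENat.forall_natCast_le_iff_le.1 fun m hm => ?_
    obtain ⟨v, hv⟩ := natCast_le_complexDim_iff.1 hm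
    have heig : ∀ i, T (v i) = Complex.exp (Complex.I * θ) • (v i : Complexification F) :=
      fun i => (hker _ _).1 (v i).2
    set w : F := ∑ i, (v i : Complexification F).modulus
    have hw : 0 ≤ w := Finset.sum_nonneg fun i _ => Complexification.modulus_nonneg _
    obtain ⟨y, hwy, hy⟩ := hpos.exists_fixedPoint_ge hKB hr.le hWS hw (by
      rw [map_sum]
      exact Finset.sum_le_sum fun i _ => hpos.modulus_le_of_eigenvector (hnorm θ) (heig i))
    obtain ⟨g, hg, hgeig⟩ := exists_linearIndependent_eigenvectors_of_dominated hKB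
      hpos.realRestriction_nonneg (hw.trans hwy) hy (hnorm θ) n
      (h := fun i => (v i : Complexification F)) (hv.map' _ (Submodule.ker_subtype _))
      (fun i => by rw [← hpos.apply_eq_mapReal, heig])
      (fun i => (Finset.single_le_sum (f := fun i => (v i : Complexification F).modulus)
        (fun i _ => Complexification.modulus_nonneg _) (Finset.mem_univ i)).trans hwy)
    refine natCast_le_complexDim_iff.2 ⟨fun i => ⟨g i, (hker _ _).2 ?_⟩, ?_⟩
    · rw [hpos.apply_eq_mapReal, hgeig, hzpow]
    · exact LinearIndependent.of_comp (Submodule.subtype _) hg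
  refine ⟨hdim, fun r θ hr0 hmem n => ?_⟩
  have hHas : ∀ μ : ℂ,
      Module.End.HasEigenvalue (T : Complexification F →ₗ[ℂ] Complexification F) μ ↔
        ((1 : ℕ) : ℕ∞) ≤ complexDim (LinearMap.ker
          ((μ • (1 : Complexification F →L[ℂ] Complexification F) - T).toLinearMap)) := by
    intro μ
    rw [natCast_le_complexDim_iff]
    constructor
    · intro h
      obtain ⟨z, hz⟩ := h.exists_hasEigenvector
      exact ⟨fun _ => ⟨z, (hker μ z).2 hz.apply_eq_smul⟩, by
        rw [linearIndependent_unique_iff]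
        exact fun h0 => hz.2 (congrArg Subtype.val h0)⟩
    · rintro ⟨z, hz⟩
      refine Module.End.hasEigenvalue_of_hasEigenvector (x := (z 0 : Complexification F))
        ⟨Module.End.mem_eigenspace_iff.2 ((hker μ _).1 (z 0).2), fun h0 => hz.ne_zero 0 ?_⟩
      exact Subtype.ext h0
  obtain rfl : r = 1 := by
    have h1 := hmem.2
    rw [hr, ENNReal.coe_eq_one] at h1
    have h2 := congrArg NNReal.toReal h1
    rwa [coe_nnnorm, norm_mul, hnorm, mul_one, Complex.norm_real, Real.norm_of_nonneg hr0] at h2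
  have hmem1 := (hHas _).1 hmem.1
  rw [Complex.ofReal_one, one_mul] at hmem1 ⊢
  refine ⟨(hHas _).2 (hmem1.trans (hdim θ n)), ?_⟩
  rw [hr, ENNReal.coe_eq_one]
  refine NNReal.eq ?_
  rw [coe_nnnorm, hzpow, norm_zpow, hnorm, one_zpow, NNReal.coe_one]
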